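/- Let $\psi_0$ be a real, primitive, even Dirichlet character modulo $N_0\ge 1$ and $\psi_1$ a real, primitive, odd Dirichlet character modulo $N_1\ge 1$. With $q=e^{2\pi i z}$ set, for $z\in\mathbb H$, $$\theta_0(z)=\sum_{n\ge 0}\psi_0(n)q^{n^2},\qquad \theta_1(z)=\sum_{n\ge 1}n\,\psi_1(n)q^{n^2},$$ with the convention $\psi_0(0)=\tfrac12$ if $\psi_0$ is trivial. Assume that $\theta_0$ and $\theta_1$ have no zeros in $\mathbb H$. Put $N=\operatorname{lcm}(4N_0^2,4N_1^2)$ and fix an integer $a$. For $k\in\frac32+\mathbb N_0$ (equivalently $2-k\in\frac12-\mathbb N_0$) and $f:\mathbb H\to\mathbb C$ holomorphic let $$\delta_a^{k-1}(f)=\theta_0^{3a-2}\,\theta_1^{1-a}\,D^{k-\frac32}\!\left(\theta_0^{1-3a}\,\theta_1^{a}\,f\right),\qquad D^{m}=(2\pi i)^{-m}\frac{d^m}{dz^m}.$$ For $\kappa\in\frac12+\mathbb Z$ and a Dirichlet character $\psi$ modulo $N$, a weakly holomorphic modular form of weight $\kappa$, level $N$ and character $\psi$ is a holomorphic function $f:\mathbb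 H\to\mathbb C$ that is meromorphic at all cusps and satisfies $$\left(\frac cd\right)\epsilon_d^{2\kappa}(cz+d)^{-\kappa}f\!\left(\frac{az+b}{cz+d}\right)=\psi(d)f(z)\qquad\text{for all }\begin{pmatrix}a&b\\c&d\end{pmatrix}\in\Gamma_0(N),$$ where $\left(\frac cd\right)$ is the Kronecker symbol, $\epsilon_d=1$ if $d\equiv1\bmod 4$ and $\epsilon_d=i$ if $d\equiv 3\bmod 4$, and powers are taken with the principal branch ($-\pi<\arg\le\pi$). Then for every $k\in\frac32+\mathbb N_0$, every Dirichlet character $\psi$ modulo $N$ and every weakly holomorphic modular form $f$ of weight $2-k$, level $N$ and character $\psi$, the function $\delta_a^{k-1}(f)$ is a weakly holomorphic modular form of weight $k$, level $N$ and character $$d\mapsto\psi(d)\left(\frac{-1}{d}\right)\frac{\psi_1(d)}{\psi_0(d)}\qquad(\gcd(d,N)=1).$$ In particular, taking $k=\tfrac32$, one has $\delta_a^{1/2}(\theta_0)=\theta_1$. -/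

import Mathlib

noncomputable section

namespace HalfIntegralBol

open UpperHalfPlane
open scoped MatrixGroups Manifold

/-- The Kronecker symbol `(c / d)` for an integer `c` and an odd integer `d`. It is the Jacobi
symbol `(c / |d|)`, times `(c / -1)` when `d < 0`, where `(c / -1) = -1` if `c < 0` and
`(c / -1) = 1` if `c ≥ 0`. -/
def kroneckerOdd (c d : ℤ) : ℤ :=
  (if c < 0 ∧ d < 0 then -1 else 1) * jacobiSym c d.natAbs

/-- `ε_d` for an odd integer `d`: it is `1` if `d ≡ 1 mod 4` and `i` if `d ≡ 3 mod 4`. -/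
def epsilonOdd (d : ℤ) : ℂ :=
  if d % 4 = 1 then 1 else Complex.I

/-- `(c z + d) ^ (-κ/2) f(γ z)` for `γ = (* *; c d)` in `SL₂(ℤ)`, with the principal branch of the
power. -/
def cuspSlash (κ : ℤ) (γ : SL(2, ℤ)) (f : ℍ → ℂ) (z : ℍ) : ℂ :=
  ((γ 1 0 : ℂ) * (z : ℂ) + (γ 1 1 : ℂ)) ^ (-(κ : ℂ) / 2) * f (γ • z)

/-- The slash action `f |_k γ` in half-integral weight `k = κ/2` (with `κ` odd) of
`γ = (* *; c d)` in `Γ₀(N)`, where `4 ∣ N`: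
`(c / d) ε_d ^ (2k) (c z + d) ^ (-k) f(γ z)`. -/
def thetaSlash (κ : ℤ) (γ : SL(2, ℤ)) (f : ℍ → ℂ) (z : ℍ) : ℂ :=
  (kroneckerOdd (γ 1 0) (γ 1 1) : ℂ) * epsilonOdd (γ 1 1) ^ κ * cuspSlash κ γ f z

/-- `g` is meromorphic at the cusp `∞`: for some integer `M ≥ 1` it is a function, meromorphic at
the origin, of the local parameter `e ^ (2 π i z / M)`. -/
def IsMeromorphicAtInfty (g : ℍ → ℂ) : Prop :=
  ∃ M : ℕ, 0 < M ∧ ∃ F : ℂ → ℂ, MeromorphicAt F 0 ∧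
    ∀ z : ℍ, g z = F (Complex.exp (2 * Real.pi * Complex.I * (z : ℂ) / M))

/-- `f` is a weakly holomorphic modular form of half-integral weight `κ/2` (with `κ` odd), level `N`
(with `4 ∣ N`) and character `ψ` modulo `N`: it is holomorphic on the upper half-plane, satisfies
`f |_{κ/2} γ = ψ(d) f` for all `γ = (* *; c d)` in `Γ₀(N)`, and is meromorphic at every cusp. -/
structure IsWeaklyHolomorphic (κ : ℤ) (N : ℕ) (ψ : DirichletCharacter ℂ N) (f : ℍ → ℂ) :
    Prop where
  holo : MDiff f
  slash_eq : ∀ γ ∈ CongruenceSubgroup.Gamma0 N, ∀ z : ℍ,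
    thetaSlash κ γ f z = ψ ((γ 1 1 : ℤ) : ZMod N) * f z
  meromorphic_at_cusps : ∀ γ : SL(2, ℤ), IsMeromorphicAtInfty (cuspSlash κ γ f)

/-- `q = e ^ (2 π i z)`. -/
def q (z : ℍ) : ℂ := Complex.exp (2 * Real.pi * Complex.I * (z : ℂ))

open Classical in
/-- `θ₀(z) = ∑_{n ≥ 0} ψ₀(n) q^(n²)`, for a primitive character `ψ₀`, with the convention that the
constant term is `1/2` if `ψ₀` is trivial. -/
def theta0 {N₀ : ℕ} (ψ₀ : DirichletCharacter ℂ N₀) (z : ℍ) : ℂ :=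
  ∑' n : ℕ, (if n = 0 ∧ ψ₀ = 1 then 1 / 2 else ψ₀ (n : ZMod N₀)) * q z ^ (n ^ 2)

/-- `θ₁(z) = ∑_{n ≥ 1} n ψ₁(n) q^(n²)`; the term `n = 0` vanishes. -/
def theta1 {N₁ : ℕ} (ψ₁ : DirichletCharacter ℂ N₁) (z : ℍ) : ℂ :=
  ∑' n : ℕ, (n : ℂ) * ψ₁ (n : ZMod N₁) * q z ^ (n ^ 2)

/-- The Bol operator `D^m = (2 π i)^(-m) d^m/dz^m`, the `m`-fold iterate of
`(2 π i)⁻¹ d/dz`. -/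
def bolD (m : ℕ) (f : ℍ → ℂ) : ℍ → ℂ :=
  Derivative.normalizedDerivOfComplex^[m] f

/-- The operator `δ_a^(k-1)` for `k = m + 3/2`:
`δ_a^(k-1)(f) = θ₀^(3a-2) θ₁^(1-a) D^(k-3/2)(θ₀^(1-3a) θ₁^a f)`. -/
def bolDelta {N₀ N₁ : ℕ} (ψ₀ : DirichletCharacter ℂ N₀) (ψ₁ : DirichletCharacter ℂ N₁)
    (a : ℤ) (m : ℕ) (f : ℍ → ℂ) (z : ℍ) : ℂ :=
  theta0 ψ₀ z ^ (3 * a - 2) * theta1 ψ₁ z ^ (1 - a) *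
    bolD m (fun w => theta0 ψ₀ w ^ (1 - 3 * a) * theta1 ψ₁ w ^ a * f w) z

end HalfIntegralBol

end

open HalfIntegralBol

noncomputable section

namespace HalfIntegralBol

open UpperHalfPlane hiding I
open scoped MatrixGroups Manifold ModularForm Topology
open Complex Real Derivative

/-! Put `s = (c/d) ε_d (cz+d)^(-1/2)`. For `γ` in `Γ₀(N)` one has `s · θ₀(γz) = ψ₀(d) θ₀(z)` and `s³
· θ₁(γz) = ε_d² ψ₁(d) θ₁(z)`, with `ε_d² = (-1/d)`. Hence `g = θ₀^(1-3a) θ₁^a f` has the integral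
weight `1 - m`, where `m = k - 3/2`. Bol's identity (`bolD_slash`) says that `D^m` intertwines the
weights `1 - m` and `1 + m`. The prefactor `θ₀^(3a-2) θ₁^(1-a)` adds weight `1/2`, and the exponents
of the two theta functions add up to `-1` and `1`, which leaves the character `ψ · (-1/d) · ψ₁/ψ₀`.
The absence of zeros keeps negative powers holomorphic.

The theta laws come from `jacobiTheta₂`. Its law for matrices with even off-diagonal entries
(`jacobiTheta₂_smul`) is proved by a Euclidean descent on the bottom row, with explicit control of
the principal branch. A finite Fourier expansion of the character carries it over to twists
(`twistedTheta_smul`). Evaluation at `z = 0` gives `θ₀`, and the derivative in `z` at `0` gives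
`θ₁`.

At the cusps constants do not matter: theta functions with rational characteristics are permuted by
`SL₂(ℤ)` up to scalars (`mapsThetaChar`) and are power series in a local parameter. Bol's identity
holds for all of `SL₂(ℤ)`, and `D` acts on the local parameter `x` as a multiple of `x d/dx`, so
meromorphy survives. -/

/-! ### Kronecker symbol and theta multiplier -/

open ZMod NumberTheorySymbols in
/-- Reflection of the Jacobi symbol with a positive numerator. -/
lemma jacobiSym_eq_of_dvd_add {a b b' : ℕ} (ha : a ≠ 0) (hb : Odd b) (hb' : Odd b')
    (h : 4 * a ∣ b + b') : jacobiSym a b = jacobiSym a b' := by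
  obtain ⟨e, t, ht, rfl⟩ := Nat.exists_eq_two_pow_mul_odd ha
  have h4 : ((b : ℕ) : ZMod 4) = -((b' : ℕ) : ZMod 4) := by
    rw [eq_neg_iff_add_eq_zero]
    exact_mod_cast (ZMod.natCast_eq_zero_iff _ _).2 ((Dvd.intro _ rfl).trans h)
  have htwo : jacobiSym 2 b ^ e = jacobiSym 2 b' ^ e := by
    rcases Nat.eq_zero_or_pos e with rfl | he
    · simp
    · have h8 : ((b : ℕ) : ZMod 8) = -((b' : ℕ) : ZMod 8) := by
        rw [eq_neg_iff_add_eq_zero]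
        obtain ⟨f, rfl⟩ := Nat.exists_eq_add_of_le' he
        have : 8 ∣ 4 * (2 ^ (f + 1) * t) := ⟨2 ^ f * t, by ring⟩
        exact_mod_cast (ZMod.natCast_eq_zero_iff _ _).2 (this.trans h)
      rw [jacobiSym.at_two hb, jacobiSym.at_two hb', h8]
      congr 1
      generalize ((b' : ℕ) : ZMod 8) = x
      revert x
      decide
  -- After reciprocity, `b ≡ -b'` modulo `t` costs `χ₄ t`, and `b ≡ -b'` modulo 4 changes the
  -- reciprocity sign by the same `χ₄ t`.
  have hodd : jacobiSym t b = jacobiSym t b' := by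
    rw [jacobiSym.quadratic_reciprocity' ht hb, jacobiSym.quadratic_reciprocity' ht hb']
    have h1 : jacobiSym b t = jacobiSym (-(b' : ℤ)) t := by
      apply jacobiSym.mod_left'
      have : (t : ℤ) ∣ (b : ℤ) + b' := by
        exact_mod_cast (Dvd.intro_left (4 * 2 ^ e) (by ring)).trans h
      exact (Int.modEq_iff_dvd.2 (by rwa [sub_neg_eq_add])).symm
    have h2 : qrSign b t = χ₄ t * qrSign b' t := by
      rw [qrSign, qrSign, h4, ← jacobiSym.neg _ ht]
      congr 1
      generalize ((b' : ℕ) : ZMod 4) = x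
      revert x
      decide
    have h3 : χ₄ (t : ZMod 4) * χ₄ (t : ZMod 4) = 1 := by
      rcases Nat.odd_mod_four_iff.1 (Nat.odd_iff.1 ht) with h | h
      · rw [χ₄_nat_one_mod_four h]; rfl
      · rw [χ₄_nat_three_mod_four h]; rfl
    rw [h1, h2, jacobiSym.neg _ ht]
    linear_combination (qrSign b' t * jacobiSym b' t) * h3
  push_cast
  rw [jacobiSym.mul_left, jacobiSym.mul_left, jacobiSym.pow_left, jacobiSym.pow_left, htwo, hodd]

lemma jacobiSym_four_mul (t : ℤ) {b : ℕ} (hb : Odd b) : jacobiSym (4 * t) b = jacobiSym t b := by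
  rw [jacobiSym.mul_left, jacobiSym.at_four hb, one_mul]

open ZMod in
/-- The sign in the Kronecker symbol makes it periodic in the denominator. -/
lemma kroneckerOdd_add_right {t d : ℤ} (hd : Odd d) :
    kroneckerOdd (4 * t) (d + 4 * t) = kroneckerOdd (4 * t) d := by
  have hd' : Odd (d + 4 * t) := hd.add_even ⟨2 * t, by ring⟩
  have hb : Odd d.natAbs := Int.natAbs_odd.2 hd
  have hb' : Odd (d + 4 * t).natAbs := Int.natAbs_odd.2 hd'
  have hd0 : d ≠ 0 := by rintro rfl; simp at hd
  have hd0' : d + 4 * t ≠ 0 := by intro h; rw [h] at hd'; simp at hd'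
  rcases eq_or_ne t 0 with rfl | ht0
  · simp
  have key : ∀ s : ℕ, s ≠ 0 → ∀ b b' : ℕ, Odd b → Odd b' →
      b' = b + 4 * s → jacobiSym s b' = jacobiSym s b := by
    intro s hs b b' hb hb' h
    rw [jacobiSym.mod_right' s hb, jacobiSym.mod_right' s hb', h, Nat.add_mod_right]
  unfold kroneckerOdd
  rw [jacobiSym_four_mul _ hb, jacobiSym_four_mul _ hb']
  have hs : t.natAbs ≠ 0 := by simpa using ht0
  have chi : ∀ b b' : ℕ, b' = b + 4 * t.natAbs → χ₄ (b' : ZMod 4) = χ₄ (b : ZMod 4) := by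
    intro b b' h
    rw [h]
    push_cast
    rw [show (4 : ZMod 4) = 0 from rfl, zero_mul, add_zero]
  have chi' : ∀ b b' : ℕ, b + b' = 4 * t.natAbs → χ₄ (b' : ZMod 4) = -χ₄ (b : ZMod 4) := by
    intro b b' h
    have : (b' : ZMod 4) = -(b : ZMod 4) := by
      rw [eq_neg_iff_add_eq_zero, add_comm]
      exact_mod_cast (ZMod.natCast_eq_zero_iff _ _).2 ⟨_, h⟩
    rw [this]
    generalize (b : ZMod 4) = x
    revert x
    decide
  -- If `d` and `d + 4t` have equal signs, their absolute values differ by `4|t|`; otherwise these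
  -- add up to `4|t|` and reflection applies. For `t < 0` the reflection flips `χ₄`, which the sign
  -- in `kroneckerOdd` undoes.
  rcases lt_or_gt_of_ne ht0 with ht | ht
  · have e : t = -(t.natAbs : ℤ) := by omega
    have J : ∀ b : ℕ, Odd b → jacobiSym t b = χ₄ (b : ZMod 4) * jacobiSym (t.natAbs : ℤ) b := by
      intro b hb
      conv_lhs => rw [e]
      exact jacobiSym.neg _ hb
    rw [J _ hb, J _ hb']
    rcases lt_or_gt_of_ne hd0 with h1 | h1 <;> rcases lt_or_gt_of_ne hd0' with h2 | h2
    · rw [key _ hs _ _ hb hb' (by omega), chi d.natAbs _ (by omega), if_pos (by omega),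
        if_pos (by omega)]
    · omega
    · rw [jacobiSym_eq_of_dvd_add hs hb' hb ⟨1, by omega⟩, chi' d.natAbs _ (by omega),
        if_pos (by omega), if_neg (by omega)]
      ring
    · rw [← key _ hs _ _ hb' hb (by omega), ← chi _ d.natAbs (by omega), if_neg (by omega),
        if_neg (by omega)]
  · have e : t = (t.natAbs : ℤ) := by omega
    have J : ∀ b : ℕ, jacobiSym t b = jacobiSym (t.natAbs : ℤ) b := fun b => by rw [← e]
    rw [if_neg (by omega), if_neg (by omega), one_mul, one_mul, J, J]
    rcases lt_or_gt_of_ne hd0 with h1 | h1 <;> rcases lt_or_gt_of_ne hd0' with h2 | h2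
    · rw [← key _ hs _ _ hb' hb (by omega)]
    · rw [jacobiSym_eq_of_dvd_add hs hb' hb ⟨1, by omega⟩]
    · omega
    · rw [key _ hs _ _ hb hb' (by omega)]

/-- The multiplier of `jacobiTheta₂` under `(* *; c d)` with `c` even. -/
def thetaMult (c d : ℤ) : ℂ := (kroneckerOdd (2 * c) d : ℂ) * (epsilonOdd d)⁻¹

lemma thetaMult_add_right {c d : ℤ} (hc : Even c) (hd : Odd d) :
    thetaMult c (d + 2 * c) = thetaMult c d := by
  obtain ⟨t, rfl⟩ := even_iff_two_dvd.1 hc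
  unfold thetaMult epsilonOdd
  rw [show 2 * (2 * t) = 4 * t by ring, kroneckerOdd_add_right hd,
    show (d + 4 * t) % 4 = d % 4 by omega]

/-- The Jacobi symbol sees its numerator only modulo `|d|`, so only the sign convention for negative
arguments can change. -/
lemma thetaMult_add_left (c d e : ℤ) :
    thetaMult (c + 2 * e * d) d =
      (if (c + 2 * e * d < 0 ∧ d < 0) ↔ (c < 0 ∧ d < 0) then 1 else -1) * thetaMult c d := by
  unfold thetaMult kroneckerOdd
  have : jacobiSym (2 * (c + 2 * e * d)) d.natAbs = jacobiSym (2 * c) d.natAbs := by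
    apply jacobiSym.mod_left'
    rw [show 2 * (c + 2 * e * d) = 2 * c + d * (4 * e) by ring]
    refine (Int.modEq_iff_dvd.2 ?_).symm
    rw [show 2 * c + d * (4 * e) - 2 * c = d * (4 * e) by ring]
    exact (Int.natAbs_dvd.2 (dvd_refl d)).mul_right _
  rw [this]
  have h1 : (2 * (c + 2 * e * d) < 0) ↔ (c + 2 * e * d < 0) := by omega
  have h2 : (2 * c < 0) ↔ (c < 0) := by omega
  simp only [h1, h2]
  split_ifs <;> first | (exfalso; tauto) | (push_cast; ring)

/-! ### Branches of the square root -/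

lemma mul_cpow_half_of_arg_add_mem {w y : ℂ} (hw : w ≠ 0) (hy : y ≠ 0)
    (h : arg w + arg y ∈ Set.Ioc (-π) π) :
    (w * y) ^ (1 / 2 : ℂ) = w ^ (1 / 2 : ℂ) * y ^ (1 / 2 : ℂ) := by
  rw [cpow_def_of_ne_zero (mul_ne_zero hw hy), cpow_def_of_ne_zero hw, cpow_def_of_ne_zero hy,
    Complex.log_mul hw hy h, add_mul, Complex.exp_add]

/-- The sum of the logarithms overshoots by `2πi`, and half of that contributes `-1`. -/
lemma mul_cpow_half_of_pi_lt {w y : ℂ} (hw : w ≠ 0) (hy : y ≠ 0) (h : π < arg w + arg y) :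
    (w * y) ^ (1 / 2 : ℂ) = -(w ^ (1 / 2 : ℂ) * y ^ (1 / 2 : ℂ)) := by
  have h1 := arg_le_pi w
  have h2 := arg_le_pi y
  have : Complex.log (w * y) = Complex.log w + Complex.log y - 2 * π * I := by
    have e : w * y = Complex.exp (Complex.log w + Complex.log y - 2 * π * I) := by
      rw [Complex.exp_sub, Complex.exp_add, exp_log hw, exp_log hy, exp_two_pi_mul_I, div_one]
    conv_lhs => rw [e]
    rw [Complex.log_exp] <;> simp [log_im] <;> linarith
  rw [cpow_def_of_ne_zero (mul_ne_zero hw hy), cpow_def_of_ne_zero hw, cpow_def_of_ne_zero hy,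
    this, ← Complex.exp_add, show (Complex.log w + Complex.log y - 2 * π * I) * (1 / 2) =
      Complex.log w * (1 / 2) + Complex.log y * (1 / 2) - π * I by ring, Complex.exp_sub,
      exp_pi_mul_I]
  ring

lemma mul_cpow_half_of_le_neg_pi {w y : ℂ} (hw : w ≠ 0) (hy : y ≠ 0)
    (h : arg w + arg y ≤ -π) :
    (w * y) ^ (1 / 2 : ℂ) = -(w ^ (1 / 2 : ℂ) * y ^ (1 / 2 : ℂ)) := by
  have h1 := neg_pi_lt_arg w
  have h2 := neg_pi_lt_arg y
  have : Complex.log (w * y) = Complex.log w + Complex.log y + 2 * π * I := by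
    have e : w * y = Complex.exp (Complex.log w + Complex.log y + 2 * π * I) := by
      rw [Complex.exp_add, Complex.exp_add, exp_log hw, exp_log hy, exp_two_pi_mul_I, mul_one]
    conv_lhs => rw [e]
    rw [Complex.log_exp] <;> simp [log_im] <;> linarith
  rw [cpow_def_of_ne_zero (mul_ne_zero hw hy), cpow_def_of_ne_zero hw, cpow_def_of_ne_zero hy,
    this, ← Complex.exp_add, show (Complex.log w + Complex.log y + 2 * π * I) * (1 / 2) =
      Complex.log w * (1 / 2) + Complex.log y * (1 / 2) + π * I by ring, Complex.exp_add _ (π * I),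
      exp_pi_mul_I]
  ring

/-- Lets the sign of an imaginary part decide whether a sum of arguments leaves `(-π, π]`. -/
lemma mul_im_eq_sin (w y : ℂ) : (w * y).im = ‖w‖ * ‖y‖ * Real.sin (arg w + arg y) := by
  conv_lhs => rw [← norm_mul_exp_arg_mul_I w, ← norm_mul_exp_arg_mul_I y]
  rw [show (‖w‖ : ℂ) * Complex.exp (arg w * I) * (‖y‖ * Complex.exp (arg y * I)) =
    ((‖w‖ * ‖y‖ : ℝ) : ℂ) * Complex.exp ((arg w + arg y : ℝ) * I) by
      push_cast; rw [add_mul, Complex.exp_add]; ring]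
  rw [im_ofReal_mul, exp_ofReal_mul_I_im]

lemma arg_pos_of_im_pos {y : ℂ} (h : 0 < y.im) : 0 < arg y :=
  lt_of_le_of_ne (arg_nonneg_iff.2 h.le) fun e => by
    have := (arg_eq_zero_iff.1 e.symm).2; linarith

lemma arg_lt_pi_of_im_ne {y : ℂ} (h : y.im ≠ 0) : arg y < π :=
  lt_of_le_of_ne (arg_le_pi y) fun e => h (arg_eq_pi_iff.1 e).2

/-- The sign by which the principal square root fails to be multiplicative. -/
lemma mul_cpow_half_of_im_pos {w y : ℂ} (hw : w ≠ 0) (hy : 0 < y.im) :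
    (w * y) ^ (1 / 2 : ℂ) = (if 0 ≤ w.im ∧ (w * y).im < 0 then -1 else 1) *
      (w ^ (1 / 2 : ℂ) * y ^ (1 / 2 : ℂ)) := by
  have hy0 : y ≠ 0 := by rintro rfl; simp at hy
  have a1 := arg_pos_of_im_pos hy
  have a2 := arg_lt_pi_of_im_ne hy.ne'
  have a3 := arg_le_pi w
  have a4 := neg_pi_lt_arg w
  have hn : 0 < ‖w‖ * ‖y‖ := by positivity
  split_ifs with h
  · rw [neg_one_mul]
    apply mul_cpow_half_of_pi_lt hw hy0
    by_contra! hle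
    have := arg_nonneg_iff.2 h.1
    have := mul_nonneg hn.le (Real.sin_nonneg_of_nonneg_of_le_pi (by linarith) hle)
    rw [← mul_im_eq_sin] at this
    linarith [h.2]
  · rw [one_mul]
    apply mul_cpow_half_of_arg_add_mem hw hy0
    refine ⟨by linarith, ?_⟩
    by_contra! hlt
    have h0 : 0 ≤ w.im := arg_nonneg_iff.1 (by linarith)
    apply h ⟨h0, ?_⟩
    rw [mul_im_eq_sin]
    apply mul_neg_of_pos_of_neg hn
    rw [← Real.sin_sub_two_pi]
    exact Real.sin_neg_of_neg_of_neg_pi_lt (by linarith) (by linarith)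

/-- The cut is now crossed in the opposite direction. The negative real axis has argument `π`, so
real values again count with the upper half-plane. -/
lemma mul_cpow_half_of_im_neg {w y : ℂ} (hw : w ≠ 0) (hy : y.im < 0) :
    (w * y) ^ (1 / 2 : ℂ) = (if w.im < 0 ∧ 0 ≤ (w * y).im then -1 else 1) *
      (w ^ (1 / 2 : ℂ) * y ^ (1 / 2 : ℂ)) := by
  have hy0 : y ≠ 0 := by rintro rfl; simp at hy
  have a1 := arg_neg_iff.2 hy
  have a2 := neg_pi_lt_arg y
  have a3 := arg_le_pi w
  have a4 := neg_pi_lt_arg w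
  have hn : 0 < ‖w‖ * ‖y‖ := by positivity
  split_ifs with h
  · rw [neg_one_mul]
    apply mul_cpow_half_of_le_neg_pi hw hy0
    by_contra! hle
    have := arg_neg_iff.2 h.1
    have := mul_neg_of_pos_of_neg hn (Real.sin_neg_of_neg_of_neg_pi_lt (by linarith) hle)
    rw [← mul_im_eq_sin] at this
    linarith [h.2]
  · rw [one_mul]
    apply mul_cpow_half_of_arg_add_mem hw hy0
    refine ⟨?_, by linarith⟩
    by_contra! hlt
    have h0 : w.im < 0 := arg_neg_iff.1 (by linarith)
    apply h ⟨h0, ?_⟩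
    rw [mul_im_eq_sin]
    apply mul_nonneg hn.le
    rw [← Real.sin_add_two_pi]
    exact Real.sin_nonneg_of_nonneg_of_le_pi (by linarith) (by linarith)

/-! ### Transformation law of the Jacobi theta function -/

lemma jacobiTheta₂_add_two_mul_int (z τ : ℂ) (k : ℤ) :
    jacobiTheta₂ z (τ + 2 * k) = jacobiTheta₂ z τ := by
  have : Function.Periodic (jacobiTheta₂ z) 2 := fun τ => jacobiTheta₂_add_right z τ
  simpa [mul_comm] using this.int_mul k τ

/-- The behaviour of `jacobiTheta₂` under the unipotent matrix `(1 0; -2e 1)`. -/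
lemma jacobiTheta₂_unipotent (e : ℤ) (z : ℂ) {τ : ℂ} (hτ : 0 < τ.im) :
    jacobiTheta₂ (z / (1 - 2 * e * τ)) (τ / (1 - 2 * e * τ)) =
      (1 - 2 * e * τ) ^ (1 / 2 : ℂ) *
        Complex.exp (π * I * (-2 * e) * z ^ 2 / (1 - 2 * e * τ)) * jacobiTheta₂ z τ := by
  have h0 : τ ≠ 0 := by rintro rfl; simp at hτ
  have hy : 1 - 2 * e * τ ≠ 0 := by
    intro h
    have him := congrArg Complex.im h
    have hre := congrArg Complex.re h
    simp at him hre
    rcases him with h | h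
    · simp [h] at hre
    · exact hτ.ne' h
  set y := 1 - 2 * e * τ with hydef
  have hT : (τ / y).im = τ.im / normSq y := by
    rw [Complex.div_im, hydef]
    have : normSq y ≠ 0 := by simpa using hy
    rw [← hydef]
    field_simp
    simp [hydef]
    ring
  have hTpos : 0 < (τ / y).im := by rw [hT]; exact div_pos hτ (normSq_pos.2 hy)
  have hT0 : τ / y ≠ 0 := div_ne_zero h0 hy
  -- The matrix is conjugate to a translation by `2e` under inversion, so the functional equation is
  -- used at both `τ / y` and `τ`.
  have e1 : -1 / (τ / y) = -1 / τ + 2 * e := by rw [hydef]; field_simp; ring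
  have e2 : z / y / (τ / y) = z / τ := by field_simp
  have f1 := jacobiTheta₂_functional_equation (z / y) (τ / y)
  have f2 := jacobiTheta₂_functional_equation z τ
  rw [e1, e2, jacobiTheta₂_add_two_mul_int] at f1
  -- Both `-iτ` and `-iτ/y` lie in the right half-plane, so their arguments are below `π/2` in
  -- absolute value and no sign appears.
  have hs : (-I * τ) ^ (1 / 2 : ℂ) = (-I * (τ / y)) ^ (1 / 2 : ℂ) * y ^ (1 / 2 : ℂ) := by
    have r1 : 0 < (-I * (τ / y)).re := by simpa using hTpos
    have r2 : 0 < (-I * τ).re := by simpa using hτ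
    have a1 := abs_lt.1 (abs_arg_lt_pi_div_two_iff.2 (Or.inl r1))
    have a2 := abs_lt.1 (abs_arg_lt_pi_div_two_iff.2 (Or.inl r2))
    have hne : arg (-I * (τ / y)) ≠ π := by linarith [a1.2, pi_pos]
    have hv0 : -I * (τ / y) ≠ 0 := mul_ne_zero (by simp) hT0
    have hyv : y = -I * τ * (-I * (τ / y))⁻¹ := by field_simp
    have hpow : y ^ (1 / 2 : ℂ) = (-I * τ) ^ (1 / 2 : ℂ) * ((-I * (τ / y)) ^ (1 / 2 : ℂ))⁻¹ := by
      rw [← inv_cpow _ _ hne]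
      conv_lhs => rw [hyv]
      apply mul_cpow_half_of_arg_add_mem (mul_ne_zero (by simp) h0) (inv_ne_zero hv0)
      rw [arg_inv, if_neg hne]
      constructor <;> linarith [a1.1, a1.2, a2.1, a2.2]
    have hvp : (-I * (τ / y)) ^ (1 / 2 : ℂ) ≠ 0 := by
      rw [Ne, cpow_eq_zero_iff, not_and_or]
      exact Or.inl hv0
    rw [hpow, mul_left_comm, mul_inv_cancel₀ hvp, mul_one]
  have hsT : (-I * (τ / y)) ^ (1 / 2 : ℂ) ≠ 0 := by
    rw [Ne, cpow_eq_zero_iff, not_and_or]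
    exact Or.inl (mul_ne_zero (by simp) hT0)
  have hsy : y ^ (1 / 2 : ℂ) ≠ 0 := by
    rw [Ne, cpow_eq_zero_iff, not_and_or]
    exact Or.inl hy
  rw [f1, f2, hs]
  have he : Complex.exp (π * I * (-2 * e) * z ^ 2 / y) * Complex.exp (-π * I * z ^ 2 / τ) =
      Complex.exp (-π * I * (z / y) ^ 2 / (τ / y)) := by
    rw [← Complex.exp_add]
    congr 1
    field_simp
    rw [hydef]
    ring
  rw [← he]
  field_simp

lemma thetaMult_zero_one : thetaMult 0 1 = 1 := by
  simp [thetaMult, kroneckerOdd, epsilonOdd]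

lemma thetaMult_zero_neg_one : thetaMult 0 (-1) = I⁻¹ := by
  simp [thetaMult, kroneckerOdd, epsilonOdd]

lemma neg_one_cpow_half : (-1 : ℂ) ^ (1 / 2 : ℂ) = I := by
  rw [cpow_def_of_ne_zero (by simp), Complex.log_neg_one,
    show (π : ℂ) * I * (1 / 2) = π / 2 * I by ring, exp_pi_div_two_mul_I]

lemma linear_im (c d : ℤ) (τ : ℂ) : ((c : ℂ) * τ + d).im = c * τ.im := by simp

lemma linear_ne_zero_of_isCoprime {c d : ℤ} (h : IsCoprime c d) {τ : ℂ} (hτ : 0 < τ.im) :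
    (c : ℂ) * τ + d ≠ 0 := by
  intro h0
  have him := congrArg Complex.im h0
  have hre := congrArg Complex.re h0
  simp at him hre
  rcases him with h1 | h1
  · subst h1
    simp at hre
    subst hre
    exact not_isCoprime_zero_zero h
  · exact hτ.ne' h1

/-- Multipliers compensate the change of branch along `(1 0; -2e 1)`. -/
lemma thetaMult_mul_cpow_half {c d e : ℤ} (he : e ≠ 0) (hcd : IsCoprime c d) {τ : ℂ}
    (hτ : 0 < τ.im) :
    thetaMult (c + 2 * e * d) d * (((c * τ + d) / (1 - 2 * e * τ)) ^ (1 / 2 : ℂ) *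
      (1 - 2 * e * τ) ^ (1 / 2 : ℂ)) = thetaMult c d * (c * τ + d) ^ (1 / 2 : ℂ) := by
  set y := 1 - 2 * (e : ℂ) * τ with hydef
  have hyim : y.im = -(2 * e * τ.im) := by simp [hydef]
  have hy : y ≠ 0 := by
    intro h
    rw [h, zero_im, zero_eq_neg] at hyim
    have : (e : ℝ) ≠ 0 := by exact_mod_cast he
    simp [this, hτ.ne'] at hyim
  have hx := linear_ne_zero_of_isCoprime hcd hτ
  set x := (c : ℂ) * τ + d with hxdef
  have hw : x / y ≠ 0 := div_ne_zero hx hy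
  have hxim : x.im = c * τ.im := linear_im c d τ
  have hwim : (x / y).im = (c + 2 * e * d : ℤ) * τ.im / normSq y := by
    rw [Complex.div_im]
    have : normSq y ≠ 0 := by simpa using hy
    field_simp
    simp [hydef, hxdef]
    ring
  have hns := normSq_pos.2 hy
  have hxy : x / y * y = x := div_mul_cancel₀ x hy
  -- The branch conditions become sign conditions on the integers `c` and `c + 2ed`, the same ones
  -- that govern `thetaMult_add_left`.
  have sx : x.im < 0 ↔ c < 0 := by
    rw [hxim]
    constructor
    · intro h; by_contra! h'
      have : (0 : ℝ) ≤ c := by exact_mod_cast h'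
      linarith [mul_nonneg this hτ.le]
    · intro h
      exact mul_neg_of_neg_of_pos (by exact_mod_cast h) hτ
  have sw : (x / y).im < 0 ↔ c + 2 * e * d < 0 := by
    rw [hwim]
    constructor
    · intro h; by_contra! h'
      have : (0 : ℝ) ≤ (c + 2 * e * d : ℤ) := by exact_mod_cast h'
      linarith [div_nonneg (mul_nonneg this hτ.le) hns.le]
    · intro h
      exact div_neg_of_neg_of_pos (mul_neg_of_neg_of_pos (by exact_mod_cast h) hτ) hns
  rw [thetaMult_add_left]
  rcases lt_or_gt_of_ne he with he | he
  · have hyp : 0 < y.im := by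
      rw [hyim]
      have : (e : ℝ) < 0 := by exact_mod_cast he
      nlinarith
    have := mul_cpow_half_of_im_pos hw hyp
    rw [hxy] at this
    simp only [this, ← not_lt, sx, sw]
    have s1 : d < 0 → 0 < e * d := fun h => by nlinarith
    have s2 : ¬ d < 0 → e * d ≤ 0 := fun h => by nlinarith [not_lt.1 h]
    rw [mul_assoc 2 e d]
    generalize e * d = p at s1 s2
    split_ifs <;> first | ring1 | (exfalso; omega)
  · have hyp : y.im < 0 := by
      rw [hyim]
      have : (0 : ℝ) < e := by exact_mod_cast he
      nlinarith
    have := mul_cpow_half_of_im_neg hw hyp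
    rw [hxy] at this
    simp only [this, ← not_lt, sx, sw]
    have s1 : d < 0 → e * d < 0 := fun h => by nlinarith
    have s2 : ¬ d < 0 → 0 ≤ e * d := fun h => by nlinarith [not_lt.1 h]
    rw [mul_assoc 2 e d]
    generalize e * d = p at s1 s2
    split_ifs <;> first | ring1 | (exfalso; omega)

/-- The transformation law of the Jacobi theta function under `(a b; c d)` in `SL₂(ℤ)` with `b`
and `c` even. -/
theorem jacobiTheta₂_smul {a b c d : ℤ} (hdet : a * d - b * c = 1) (hb : Even b) (hc : Even c)
    (z : ℂ) {τ : ℂ} (hτ : 0 < τ.im) :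
    jacobiTheta₂ (z / (c * τ + d)) ((a * τ + b) / (c * τ + d)) =
      thetaMult c d * (c * τ + d) ^ (1 / 2 : ℂ) *
        Complex.exp (π * I * c * z ^ 2 / (c * τ + d)) * jacobiTheta₂ z τ := by
  induction hn : c.natAbs + d.natAbs using Nat.strong_induction_on generalizing a b c d z τ with
  | _ n ih =>
  have hd : Odd d := by
    rw [← Int.not_even_iff_odd]
    intro h
    have : Even (1 : ℤ) := by
      rw [← hdet]; exact (h.mul_left a).sub (hb.mul_right c)
    exact absurd this (by decide)
  have hcop : IsCoprime c d := ⟨-b, a, by linarith⟩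
  -- End of the descent: `d = ±1`. For `d = -1` the root `(-1)^(1/2) = i` cancels against `ε_d⁻¹ =
  -- i⁻¹`.
  rcases eq_or_ne c 0 with rfl | hc0
  · obtain ⟨k, rfl⟩ := even_iff_two_dvd.1 hb
    have had : a * d = 1 := by linarith
    rcases Int.mul_eq_one_iff_eq_one_or_neg_one.1 had with ⟨rfl, rfl⟩ | ⟨rfl, rfl⟩
    · have := jacobiTheta₂_add_two_mul_int z τ k
      simpa [thetaMult_zero_one] using this
    · have := jacobiTheta₂_add_two_mul_int z τ (-k)
      rw [thetaMult_zero_neg_one]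
      push_cast at this ⊢
      rw [zero_mul, zero_add, neg_one_cpow_half, div_neg, div_one, jacobiTheta₂_neg_left,
        show (-1 * τ + 2 * k) / -1 = τ + 2 * -k by ring, this]
      simp
  · have hd0 : d ≠ 0 := by rintro rfl; simp at hd
    have hx := linear_ne_zero_of_isCoprime hcop hτ
    -- As `c` is even and `d` odd, `|c| ≠ |d|`. Adding `±2` times the smaller entry to the larger
    -- one strictly shrinks the latter.
    rcases lt_or_ge c.natAbs d.natAbs with hlt | hge
    · obtain ⟨e, he⟩ : ∃ e : ℤ, (d + 2 * e * c).natAbs < d.natAbs ∧ (e = 1 ∨ e = -1) := by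
        rcases lt_or_gt_of_ne hc0 with h1 | h1 <;> rcases lt_or_gt_of_ne hd0 with h2 | h2
        · exact ⟨-1, by omega, by omega⟩
        · exact ⟨1, by omega, by omega⟩
        · exact ⟨1, by omega, by omega⟩
        · exact ⟨-1, by omega, by omega⟩
      have hm : thetaMult c (d + 2 * e * c) = thetaMult c d := by
        rcases he.2 with rfl | rfl
        · simpa using thetaMult_add_right hc hd
        · have h2 : Odd (d + 2 * -1 * c) := hd.add_even (hc.mul_left _)
          have := thetaMult_add_right hc h2
          rw [show d + 2 * -1 * c + 2 * c = d by ring] at this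
          exact this.symm
      have hτ' : 0 < (τ + 2 * (-e : ℤ)).im := by simpa using hτ
      have key := ih _ (by omega) (a := a) (b := b + 2 * e * a) (c := c) (d := d + 2 * e * c)
        (by linear_combination hdet) (hb.add ((even_two_mul e).mul_right a)) hc z hτ' rfl
      rw [jacobiTheta₂_add_two_mul_int, hm] at key
      push_cast at key
      rw [show (c : ℂ) * (τ + 2 * -e) + (d + 2 * e * c) = c * τ + d by ring,
        show (a : ℂ) * (τ + 2 * -e) + (b + 2 * e * a) = a * τ + b by ring] at key
      exact key
    · obtain ⟨e, he⟩ : ∃ e : ℤ, (c + 2 * e * d).natAbs < c.natAbs ∧ (e = 1 ∨ e = -1) := by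
        have : c.natAbs ≠ d.natAbs := by
          intro h
          have h1 := Int.natAbs_even.2 hc
          rw [h] at h1
          exact (Nat.not_even_iff_odd.2 (Int.natAbs_odd.2 hd)) h1
        rcases lt_or_gt_of_ne hc0 with h1 | h1 <;> rcases lt_or_gt_of_ne hd0 with h2 | h2
        · exact ⟨-1, by omega, by omega⟩
        · exact ⟨1, by omega, by omega⟩
        · exact ⟨1, by omega, by omega⟩
        · exact ⟨-1, by omega, by omega⟩
      have he0 : e ≠ 0 := by omega
      have hy : 1 - 2 * (e : ℂ) * τ ≠ 0 := by
        have h1 : IsCoprime (-2 * e) (1 : ℤ) := isCoprime_one_right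
        have := linear_ne_zero_of_isCoprime h1 hτ
        push_cast at this
        rwa [show -2 * (e : ℂ) * τ + 1 = 1 - 2 * e * τ by ring] at this
      have hτ' : 0 < (τ / (1 - 2 * e * τ)).im := by
        have : (τ / (1 - 2 * e * τ)).im = τ.im / normSq (1 - 2 * e * τ) := by
          rw [Complex.div_im]
          have : normSq (1 - 2 * e * τ) ≠ 0 := by simpa using hy
          field_simp
          simp
          ring
        rw [this]
        exact div_pos hτ (normSq_pos.2 hy)
      have hmul := thetaMult_mul_cpow_half he0 hcop hτ
      have key := ih _ (by omega) (a := a + 2 * e * b) (b := b) (c := c + 2 * e * d) (d := d)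
        (by linear_combination hdet) hb (hc.add ((even_two_mul e).mul_right d))
        (z / (1 - 2 * e * τ)) hτ' rfl
      rw [jacobiTheta₂_unipotent e z hτ] at key
      push_cast at key
      set y := 1 - 2 * (e : ℂ) * τ with hydef
      have e1 : ((c : ℂ) + 2 * e * d) * (τ / y) + d = (c * τ + d) / y := by
        field_simp; rw [hydef]; ring
      have e2 : ((a : ℂ) + 2 * e * b) * (τ / y) + b = (a * τ + b) / y := by
        field_simp; rw [hydef]; ring
      rw [e1, e2, div_div_div_cancel_right₀ hy, div_div_div_cancel_right₀ hy] at key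
      rw [key, ← hmul]
      have he : Complex.exp (π * I * c * z ^ 2 / (c * τ + d)) =
          Complex.exp (π * I * (c + 2 * e * d) * (z / y) ^ 2 / ((c * τ + d) / y)) *
          Complex.exp (π * I * (-2 * e) * z ^ 2 / y) := by
        rw [← Complex.exp_add]
        congr 1
        field_simp
        rw [hydef]
        ring
      rw [he]
      ring

/-! ### Twists by functions modulo r -/

/-- The twist of the Jacobi theta series by a function `φ` on `ℤ/rℤ`. -/
def twistedTheta {r : ℕ} (φ : ZMod r → ℂ) (z τ : ℂ) : ℂ :=
  ∑' n : ℤ, φ n * jacobiTheta₂_term n z τ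

section twist
variable {r : ℕ} [NeZero r]

open scoped ZMod

/-- Coefficients of the expansion of `φ` in additive characters. -/
def fourierCoeff (φ : ZMod r → ℂ) (u : ZMod r) : ℂ := (r : ℂ)⁻¹ * ZMod.dft φ u

lemma sum_fourierCoeff (φ : ZMod r → ℂ) (k : ZMod r) :
    ∑ u, fourierCoeff φ u * ZMod.stdAddChar (u * k) = φ k := by
  have h : ZMod.dft.symm (ZMod.dft φ) k = φ k := by rw [LinearEquiv.symm_apply_apply]
  rw [ZMod.invDFT_apply, smul_eq_mul, Finset.mul_sum] at h
  rw [← h]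
  refine Finset.sum_congr rfl fun u _ => ?_
  rw [fourierCoeff, smul_eq_mul]
  ring

/-- Shifting `z` by `ud/r` multiplies the `n`-th term by the additive character `e(udn/r)`. The
parameter `d` is kept because the modular transformation turns `φ` into `φ(d ·)`. -/
lemma hasSum_twistedTheta (φ : ZMod r → ℂ) (d : ℤ) (z : ℂ) {τ : ℂ} (hτ : 0 < τ.im) :
    HasSum (fun n : ℤ => φ ((d * n : ℤ)) * jacobiTheta₂_term n z τ)
      (∑ u : ZMod r, fourierCoeff φ u * jacobiTheta₂ (z + u.val * d / r) τ) := by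
  have h := hasSum_sum (s := Finset.univ) fun (u : ZMod r) _ =>
    (hasSum_jacobiTheta₂_term (z + u.val * d / r) hτ).mul_left (fourierCoeff φ u)
  refine h.congr_fun fun n => ?_
  rw [← sum_fourierCoeff φ, Finset.sum_mul]
  refine Finset.sum_congr rfl fun u _ => ?_
  rw [mul_assoc]
  congr 1
  have hu : u * ((d * n : ℤ) : ZMod r) = ((u.val * d * n : ℤ) : ZMod r) := by
    push_cast
    rw [ZMod.natCast_zmod_val]
    ring
  rw [hu, ZMod.stdAddChar_coe, jacobiTheta₂_term, jacobiTheta₂_term, ← Complex.exp_add]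
  congr 1
  push_cast
  ring

lemma sum_fourierCoeff_mul_jacobiTheta₂ (φ : ZMod r → ℂ) (d : ℤ) (z : ℂ) {τ : ℂ}
    (hτ : 0 < τ.im) :
    ∑ u : ZMod r, fourierCoeff φ u * jacobiTheta₂ (z + u.val * d / r) τ =
      twistedTheta (fun k : ZMod r => φ (d * k)) z τ := by
  rw [twistedTheta, ← (hasSum_twistedTheta φ d z hτ).tsum_eq]
  push_cast
  rfl

lemma twistedTheta_eq_sum (φ : ZMod r → ℂ) (z : ℂ) {τ : ℂ} (hτ : 0 < τ.im) :
    twistedTheta φ z τ =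
      ∑ u : ZMod r, fourierCoeff φ u * jacobiTheta₂ (z + u.val / r) τ := by
  have := sum_fourierCoeff_mul_jacobiTheta₂ φ 1 z hτ
  simpa using this.symm

lemma jacobiTheta₂_add_int_mul (z τ : ℂ) (k : ℤ) :
    jacobiTheta₂ (z + k * τ) τ =
      Complex.exp (-π * I * (k ^ 2 * τ + 2 * k * z)) * jacobiTheta₂ z τ := by
  rw [jacobiTheta₂, jacobiTheta₂, ← tsum_mul_left, ← (Equiv.addRight k).tsum_eq
    (fun n => Complex.exp _ * jacobiTheta₂_term n z τ)]
  refine tsum_congr fun n => ?_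
  simp_rw [jacobiTheta₂_term, Equiv.coe_addRight, ← Complex.exp_add]
  congr 1
  push_cast
  ring

/-- The transformation law of twisted theta functions. -/
theorem twistedTheta_smul (φ : ZMod r → ℂ) {a b c d : ℤ} (hdet : a * d - b * c = 1)
    (hb : Even b) (hc : 2 * (r : ℤ) ^ 2 ∣ c) (z : ℂ) {τ : ℂ} (hτ : 0 < τ.im)
    (hτ' : 0 < ((a * τ + b) / (c * τ + d)).im) :
    twistedTheta φ (z / (c * τ + d)) ((a * τ + b) / (c * τ + d)) =
      thetaMult c d * (c * τ + d) ^ (1 / 2 : ℂ) *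
        Complex.exp (π * I * c * z ^ 2 / (c * τ + d)) *
          twistedTheta (fun k : ZMod r => φ (d * k)) z τ := by
  have hr : (r : ℂ) ≠ 0 := NeZero.ne _
  have hx := linear_ne_zero_of_isCoprime (⟨-b, a, by linarith⟩ : IsCoprime c d) hτ
  rw [twistedTheta_eq_sum φ _ hτ', ← sum_fourierCoeff_mul_jacobiTheta₂ φ d z hτ, Finset.mul_sum]
  refine Finset.sum_congr rfl fun u _ => ?_
  obtain ⟨t, rfl⟩ := hc
  -- `(u/r)(cτ + d) = ud/r + (cu/r)τ`, and `cu/r = 2rtu` is an integer, so quasi-periodicity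
  -- applies.
  have hshift : z / (((2 * (r : ℤ) ^ 2 * t : ℤ) : ℂ) * τ + d) + u.val / r =
      (z + u.val * d / r + (2 * r * t * u.val : ℤ) * τ) /
        (((2 * (r : ℤ) ^ 2 * t : ℤ) : ℂ) * τ + d) := by
    field_simp
    push_cast
    ring
  -- The leftover phase is `exp(-2πi t u² d) = 1`; here `2r² ∣ c` is essential.
  have hexp : Complex.exp (π * I * ((2 * (r : ℤ) ^ 2 * t : ℤ) : ℂ) *
        (z + u.val * d / r + (2 * r * t * u.val : ℤ) * τ) ^ 2 /
          (((2 * (r : ℤ) ^ 2 * t : ℤ) : ℂ) * τ + d)) *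
      Complex.exp (-π * I * ((2 * r * t * u.val : ℤ) ^ 2 * τ +
        2 * (2 * r * t * u.val : ℤ) * (z + u.val * d / r))) =
      Complex.exp (π * I * ((2 * (r : ℤ) ^ 2 * t : ℤ) : ℂ) * z ^ 2 /
          (((2 * (r : ℤ) ^ 2 * t : ℤ) : ℂ) * τ + d)) := by
    rw [← Complex.exp_add, Complex.exp_eq_exp_iff_exists_int]
    refine ⟨-(t * u.val ^ 2 * d), ?_⟩
    field_simp
    push_cast
    ring
  rw [hshift, jacobiTheta₂_smul hdet hb (by simp [mul_assoc]) _ hτ, jacobiTheta₂_add_int_mul,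
    ← hexp]
  ring

end twist

/-! ### Local parameter; the series θ₀ and θ₁ as twists -/

/-- A series in powers of `e ^ (2 π i z / M)` that converges on the upper half-plane is a
holomorphic function of the local parameter on the open unit disc. -/
lemma exists_differentiableOn_ball_of_summable {ι : Type*} (a : ι → ℂ) (k : ι → ℕ) {M : ℕ}
    (hM : 0 < M)
    (h : ∀ z : ℍ, Summable fun n => a n * Complex.exp (2 * π * I * z / M) ^ k n) :
    ∃ F : ℂ → ℂ, DifferentiableOn ℂ F (Metric.ball 0 1) ∧
      ∀ z : ℍ, ∑' n, a n * Complex.exp (2 * π * I * z / M) ^ k n =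
        F (Complex.exp (2 * π * I * z / M)) := by
  refine ⟨fun x => ∑' n, a n * x ^ k n, fun x hx => ?_, fun z => rfl⟩
  obtain ⟨r, hxr, hr1⟩ := exists_between (mem_ball_zero_iff.1 hx)
  have hr0 : 0 < r := (norm_nonneg x).trans_lt hxr
  have hM' : (0 : ℝ) < M := by exact_mod_cast hM
  -- The height on the imaginary axis at which the local parameter equals `r`; convergence there
  -- supplies the majorant for the M-test.
  have hy : 0 < -(M * Real.log r) / (2 * π) := by
    have := Real.log_neg hr0 hr1
    apply div_pos (by nlinarith) (by positivity)
  have hs := (h ⟨I * (-(M * Real.log r) / (2 * π) : ℝ), by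
    rwa [mul_comm, im_ofReal_mul, Complex.I_im, mul_one]⟩).norm
  have he : ∀ n, ‖a n * Complex.exp (2 * π * I * (I * (-(M * Real.log r) / (2 * π) : ℝ)) / M) ^ k n‖ =
      ‖a n‖ * r ^ k n := by
    intro n
    have hM0 : (M : ℂ) ≠ 0 := by exact_mod_cast hM.ne'
    rw [norm_mul, norm_pow]
    have : 2 * π * I * (I * (-(M * Real.log r) / (2 * π) : ℝ)) / M = (Real.log r : ℂ) := by
      push_cast
      have : (π : ℂ) ≠ 0 := by exact_mod_cast pi_ne_zero
      field_simp
      rw [I_sq]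
      ring
    rw [this, ← Complex.ofReal_exp, Real.exp_log hr0, Complex.norm_real, Real.norm_of_nonneg hr0.le]
  replace hs : Summable fun n => ‖a n‖ * r ^ k n := hs.congr he
  have hd : DifferentiableOn ℂ (fun x => ∑' n, a n * x ^ k n) (Metric.ball 0 r) := by
    apply differentiableOn_tsum_of_summable_norm hs
    · intro n
      fun_prop
    · exact Metric.isOpen_ball
    · intro n w hw
      rw [norm_mul, norm_pow]
      have := (mem_ball_zero_iff.1 hw).le
      gcongr
  exact ((hd x (mem_ball_zero_iff.2 hxr)).differentiableAt
    (Metric.isOpen_ball.mem_nhds (mem_ball_zero_iff.2 hxr))).differentiableWithinAt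

lemma norm_exp_lt_one (z : ℍ) {M : ℕ} (hM : 0 < M) : ‖Complex.exp (2 * π * I * z / M)‖ < 1 := by
  have hM' : (0 : ℝ) < M := by exact_mod_cast hM
  rw [Complex.norm_exp, Real.exp_lt_one_iff, show 2 * π * I * (z : ℂ) / M =
    ((2 * π / M : ℝ) : ℂ) * (I * z) by push_cast; ring, re_ofReal_mul]
  simp only [mul_re, Complex.I_re, zero_mul, Complex.I_im, one_mul, zero_sub, coe_im]
  have := z.im_pos
  have : 0 < 2 * π / M * z.im := by positivity
  linarith

lemma isMeromorphicAtInfty_of_differentiableOn_ball {g : ℍ → ℂ} {M : ℕ} (hM : 0 < M) {F : ℂ → ℂ}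
    (hF : DifferentiableOn ℂ F (Metric.ball 0 1))
    (h : ∀ z : ℍ, g z = F (Complex.exp (2 * π * I * z / M))) : IsMeromorphicAtInfty g :=
  ⟨M, hM, F, (hF.analyticAt (Metric.ball_mem_nhds 0 one_pos)).meromorphicAt, h⟩

lemma mdiff_of_differentiableOn_ball {g : ℍ → ℂ} {M : ℕ} (hM : 0 < M) {F : ℂ → ℂ}
    (hF : DifferentiableOn ℂ F (Metric.ball 0 1))
    (h : ∀ z : ℍ, g z = F (Complex.exp (2 * π * I * z / M))) : MDiff g := by
  rw [UpperHalfPlane.mdifferentiable_iff]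
  have : DifferentiableOn ℂ (fun z : ℂ => F (Complex.exp (2 * π * I * z / M)))
      upperHalfPlaneSet := by
    refine hF.comp (by fun_prop) fun z hz => mem_ball_zero_iff.2 ?_
    exact norm_exp_lt_one ⟨z, hz⟩ hM
  refine this.congr fun z hz => ?_
  rw [Function.comp_apply, h, ofComplex_apply_of_im_pos hz]

section
variable {r : ℕ} [NeZero r]

lemma summable_twistedTheta' (φ : ZMod r → ℂ) (z : ℂ) {τ : ℂ} (hτ : 0 < τ.im) :
    HasSum (fun n : ℤ => φ n * jacobiTheta₂'_term n z τ)
      (∑ u : ZMod r, fourierCoeff φ u * jacobiTheta₂' (z + u.val / r) τ) := by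
  have h := hasSum_sum (s := Finset.univ) fun (u : ZMod r) _ =>
    (hasSum_jacobiTheta₂'_term (z + u.val / r) hτ).mul_left (fourierCoeff φ u)
  refine h.congr_fun fun n => ?_
  rw [← sum_fourierCoeff φ, Finset.sum_mul]
  refine Finset.sum_congr rfl fun u _ => ?_
  rw [mul_assoc]
  congr 1
  have hu : u * (n : ZMod r) = ((u.val * n : ℤ) : ZMod r) := by
    push_cast
    rw [ZMod.natCast_zmod_val]
  rw [hu, ZMod.stdAddChar_coe, jacobiTheta₂'_term, jacobiTheta₂'_term, jacobiTheta₂_term,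
    jacobiTheta₂_term, mul_left_comm, ← Complex.exp_add]
  congr 2
  push_cast
  ring

/-- The derivative of the twisted theta function in the first variable. -/
def twistedTheta' (φ : ZMod r → ℂ) (z τ : ℂ) : ℂ := ∑' n : ℤ, φ n * jacobiTheta₂'_term n z τ

lemma hasDerivAt_twistedTheta (φ : ZMod r → ℂ) (z : ℂ) {τ : ℂ} (hτ : 0 < τ.im) :
    HasDerivAt (fun z => twistedTheta φ z τ) (twistedTheta' φ z τ) z := by
  rw [twistedTheta', (summable_twistedTheta' φ z hτ).tsum_eq]
  have e : (fun z => twistedTheta φ z τ) = fun z =>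
      ∑ u : ZMod r, fourierCoeff φ u * jacobiTheta₂ (z + u.val / r) τ :=
    funext fun z => twistedTheta_eq_sum φ z hτ
  rw [e]
  refine HasDerivAt.fun_sum fun u _ => HasDerivAt.const_mul _ ?_
  exact (hasDerivAt_jacobiTheta₂_fst _ hτ).comp_add_const z _

end

lemma two_mul_im_pos (z : ℍ) : 0 < (2 * (z : ℂ)).im := by simpa using z.im_pos

lemma q_pow_sq (z : ℍ) (n : ℤ) : jacobiTheta₂_term n 0 (2 * z) = q z ^ n.natAbs ^ 2 := by
  rw [jacobiTheta₂_term, q, ← Complex.exp_nat_mul]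
  congr 1
  push_cast
  have : ((n.natAbs : ℂ)) ^ 2 = (n : ℂ) ^ 2 := by
    have := congrArg (Int.cast (R := ℂ)) (Int.natAbs_sq n)
    push_cast at this
    rwa [Nat.cast_natAbs]
  rw [this]
  ring

/-- Folding a sum over `ℤ` halves the term at `0`, the origin of the convention `ψ₀(0) = 1/2`. -/
lemma HasSum.nat_of_even {f : ℤ → ℂ} {s : ℂ} (h : HasSum f s) (he : ∀ n, f (-n) = f n) :
    HasSum (fun n : ℕ => if n = 0 then f 0 / 2 else f n) (s / 2) := by
  have h1 := (h.nat_add_neg.div_const 2).sub (hasSum_ite_eq (0 : ℕ) (f 0 / 2))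
  rw [show (s + f 0) / 2 - f 0 / 2 = s / 2 by ring] at h1
  refine h1.congr_fun fun n => ?_
  rw [he]
  split_ifs with h
  · subst h; simp; ring
  · ring

lemma theta0_eq {N₀ : ℕ} [NeZero N₀] {ψ₀ : DirichletCharacter ℂ N₀} (hp : ψ₀.IsPrimitive)
    (he : ψ₀.Even) (z : ℍ) : theta0 ψ₀ z = twistedTheta ψ₀ 0 (2 * z) / 2 := by
  have hs := hasSum_twistedTheta ψ₀ 1 0 (two_mul_im_pos z)
  simp only [one_mul] at hs
  have h2 := HasSum.nat_of_even hs.summable.hasSum (fun n => by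
    rw [q_pow_sq, q_pow_sq, Int.natAbs_neg, Int.cast_neg, he.eval_neg])
  rw [twistedTheta, ← h2.tsum_eq, theta0]
  refine tsum_congr fun n => ?_
  rw [q_pow_sq, q_pow_sq]
  rcases eq_or_ne n 0 with rfl | hn
  -- A primitive trivial character has modulus 1, so its value at `0` is `1`; every other `ψ₀`
  -- vanishes at `0`.
  · by_cases h : ψ₀ = 1
    · have h1 : N₀ = 1 := by
        have := hp
        rw [h, DirichletCharacter.isPrimitive_def, DirichletCharacter.conductor_one] at this
        · exact this.symm
      subst h1
      have h0 : (0 : ZMod 1) = 1 := rfl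
      simp [h, h0]
    · have h1 : N₀ ≠ 1 := by
        rintro rfl
        exact h (DirichletCharacter.level_one ψ₀)
      have : ¬ IsUnit (0 : ZMod N₀) := by
        have : Fact (1 < N₀) := ⟨by have := NeZero.pos N₀; omega⟩
        exact not_isUnit_zero
      simp [h, ψ₀.map_nonunit this]
  · simp [hn]

/-- Differentiation in `z` brings down `2πi n`, which makes the summand even for odd `ψ₁`; folding
contributes the remaining factor 2 of `4πi`. -/
lemma theta1_eq {N₁ : ℕ} [NeZero N₁] {ψ₁ : DirichletCharacter ℂ N₁}
    (ho : ψ₁.Odd) (z : ℍ) : theta1 ψ₁ z = twistedTheta' ψ₁ 0 (2 * z) / (4 * π * I) := by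
  have hs := summable_twistedTheta' ψ₁ 0 (two_mul_im_pos z)
  have h2 := (HasSum.nat_of_even hs.summable.hasSum (fun n => by
    rw [jacobiTheta₂'_term, jacobiTheta₂'_term, q_pow_sq, q_pow_sq, Int.natAbs_neg, Int.cast_neg,
      ho.eval_neg]; push_cast; ring)).div_const (2 * π * I)
  rw [twistedTheta', show ∀ s : ℂ, s / (4 * π * I) = s / 2 / (2 * π * I) from fun s => by
    rw [div_div]; congr 1; ring, ← h2.tsum_eq, theta1]
  refine tsum_congr fun n => ?_
  rw [jacobiTheta₂'_term, jacobiTheta₂'_term, q_pow_sq, q_pow_sq]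
  have hpi : (π : ℂ) ≠ 0 := by exact_mod_cast pi_ne_zero
  rcases eq_or_ne n 0 with rfl | hn
  · simp
  · simp only [hn, if_false, Int.natAbs_natCast, Int.cast_natCast]
    field_simp

lemma exp_div_one (z : ℍ) : Complex.exp (2 * π * I * z / (1 : ℕ)) = q z := by
  rw [q]; norm_num

lemma mdiff_theta0 {N₀ : ℕ} [NeZero N₀] {ψ₀ : DirichletCharacter ℂ N₀} (hp : ψ₀.IsPrimitive)
    (he : ψ₀.Even) : MDiff (theta0 ψ₀) := by
  have hs : ∀ z : ℍ, Summable fun n : ℤ =>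
      (ψ₀ n / 2) * Complex.exp (2 * π * I * z / (1 : ℕ)) ^ (n.natAbs ^ 2) := fun z => by
    have := (hasSum_twistedTheta ψ₀ 1 0 (two_mul_im_pos z)).summable.div_const 2
    refine this.congr fun n => ?_
    rw [q_pow_sq, exp_div_one, one_mul]
    ring
  obtain ⟨F, hF, h⟩ := exists_differentiableOn_ball_of_summable _ _ one_pos hs
  refine mdiff_of_differentiableOn_ball one_pos hF fun z => ?_
  rw [← h, theta0_eq hp he, twistedTheta, ← tsum_div_const]
  refine tsum_congr fun n => ?_
  rw [q_pow_sq, exp_div_one]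
  ring

lemma mdiff_theta1 {N₁ : ℕ} [NeZero N₁] {ψ₁ : DirichletCharacter ℂ N₁}
    (ho : ψ₁.Odd) : MDiff (theta1 ψ₁) := by
  have hs : ∀ z : ℍ, Summable fun n : ℤ =>
      (ψ₁ n * (2 * π * I * n) / (4 * π * I)) *
        Complex.exp (2 * π * I * z / (1 : ℕ)) ^ (n.natAbs ^ 2) := fun z => by
    have := (summable_twistedTheta' ψ₁ 0 (two_mul_im_pos z)).summable.div_const (4 * π * I)
    refine this.congr fun n => ?_
    rw [jacobiTheta₂'_term, q_pow_sq, exp_div_one]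
    ring
  obtain ⟨F, hF, h⟩ := exists_differentiableOn_ball_of_summable _ _ one_pos hs
  refine mdiff_of_differentiableOn_ball one_pos hF fun z => ?_
  rw [← h, theta1_eq ho, twistedTheta', ← tsum_div_const]
  refine tsum_congr fun n => ?_
  rw [jacobiTheta₂'_term, q_pow_sq, exp_div_one]
  ring

/-! ### Automorphy factors; transformation of θ₀ and θ₁ -/

/-- The principal square root of `(c z + d)⁻¹`. -/
def rootFactor (γ : SL(2, ℤ)) (z : ℍ) : ℂ := ((γ 1 0 : ℂ) * z + γ 1 1) ^ (-(1 / 2) : ℂ)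

lemma det_int (γ : SL(2, ℤ)) : γ 0 0 * γ 1 1 - γ 0 1 * γ 1 0 = 1 := by
  rw [← Matrix.det_fin_two, γ.det_coe]

lemma isCoprime_row (γ : SL(2, ℤ)) : IsCoprime (γ 1 0) (γ 1 1) :=
  ⟨-γ 0 1, γ 0 0, by linarith [det_int γ]⟩

lemma coe_smul_int (γ : SL(2, ℤ)) (z : ℍ) :
    ((γ • z : ℍ) : ℂ) = ((γ 0 0 : ℂ) * z + γ 0 1) / ((γ 1 0 : ℂ) * z + γ 1 1) := by
  rw [coe_specialLinearGroup_apply]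
  simp

lemma denom_int_ne_zero (γ : SL(2, ℤ)) (z : ℍ) : (γ 1 0 : ℂ) * z + γ 1 1 ≠ 0 :=
  linear_ne_zero_of_isCoprime (isCoprime_row γ) z.im_pos

lemma rootFactor_ne_zero (γ : SL(2, ℤ)) (z : ℍ) : rootFactor γ z ≠ 0 := by
  rw [rootFactor, Ne, cpow_eq_zero_iff, not_and_or]
  exact Or.inl (denom_int_ne_zero γ z)

lemma rootFactor_inv (γ : SL(2, ℤ)) (z : ℍ) :
    (rootFactor γ z)⁻¹ = ((γ 1 0 : ℂ) * z + γ 1 1) ^ (1 / 2 : ℂ) := by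
  rw [rootFactor, cpow_neg, inv_inv]

lemma rootFactor_sq (γ : SL(2, ℤ)) (z : ℍ) :
    rootFactor γ z ^ 2 = ((γ 1 0 : ℂ) * z + γ 1 1)⁻¹ := by
  rw [rootFactor, ← cpow_nat_mul, ← cpow_neg_one]
  norm_num

lemma cuspSlash_eq (κ : ℤ) (γ : SL(2, ℤ)) (f : ℍ → ℂ) (z : ℍ) :
    cuspSlash κ γ f z = rootFactor γ z ^ κ * f (γ • z) := by
  rw [cuspSlash, rootFactor, ← cpow_int_mul]
  congr 2
  ring

lemma epsilonOdd_ne_zero (d : ℤ) : epsilonOdd d ≠ 0 := by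
  unfold epsilonOdd; split_ifs <;> simp

lemma epsilonOdd_sq {d : ℤ} (hd : Odd d) : epsilonOdd d ^ 2 = kroneckerOdd (-1) d := by
  have hd' : Odd d.natAbs := Int.natAbs_odd.2 hd
  unfold epsilonOdd kroneckerOdd
  rw [jacobiSym.at_neg_one hd']
  have h2 : d % 2 = 1 := Int.odd_iff.1 hd
  rcases Nat.odd_mod_four_iff.1 (Nat.odd_iff.1 hd') with h | h
  · rw [ZMod.χ₄_nat_one_mod_four h]
    split_ifs <;> first | (exfalso; omega) | simp
  · rw [ZMod.χ₄_nat_three_mod_four h]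
    split_ifs <;> first | (exfalso; omega) | simp

lemma epsilonOdd_pow_four (d : ℤ) : epsilonOdd d ^ 4 = 1 := by
  unfold epsilonOdd; split_ifs <;> simp

lemma kroneckerOdd_sq {c d : ℤ} (h : IsCoprime c d) : (kroneckerOdd c d : ℂ) ^ 2 = 1 := by
  have h1 : jacobiSym c d.natAbs ^ 2 = 1 := by
    apply jacobiSym.sq_one
    rw [Int.gcd_eq_natAbs, Int.natAbs_natCast, ← Int.gcd_eq_natAbs]
    exact Int.isCoprime_iff_gcd_eq_one.1 h
  unfold kroneckerOdd
  push_cast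
  rw [mul_pow]
  have h2 : ((jacobiSym c d.natAbs : ℤ) : ℂ) ^ 2 = 1 := by exact_mod_cast h1
  rw [h2]
  split_ifs <;> simp

lemma kroneckerOdd_zpow {c d : ℤ} (h : IsCoprime c d) {κ : ℤ} (hκ : Odd κ) :
    (kroneckerOdd c d : ℂ) ^ κ = kroneckerOdd c d := by
  obtain ⟨k, rfl⟩ := hκ
  have h2 := kroneckerOdd_sq h
  have h0 : (kroneckerOdd c d : ℂ) ≠ 0 := by intro h; simp [h] at h2
  rw [zpow_add₀ h0, zpow_mul, zpow_one]
  have : (kroneckerOdd c d : ℂ) ^ (2 : ℤ) = 1 := by exact_mod_cast h2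
  rw [this, one_zpow, one_mul]

/-- The weight `1/2` factor whose odd powers give the slash action on `Γ₀(N)`. -/
def thetaFactor (γ : SL(2, ℤ)) (z : ℍ) : ℂ :=
  kroneckerOdd (γ 1 0) (γ 1 1) * epsilonOdd (γ 1 1) * rootFactor γ z

lemma thetaFactor_ne_zero (γ : SL(2, ℤ)) (z : ℍ) : thetaFactor γ z ≠ 0 := by
  have h2 := kroneckerOdd_sq (isCoprime_row γ)
  have h0 : (kroneckerOdd (γ 1 0) (γ 1 1) : ℂ) ≠ 0 := by intro h; simp [h] at h2
  exact mul_ne_zero (mul_ne_zero h0 (epsilonOdd_ne_zero _)) (rootFactor_ne_zero γ z)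

lemma thetaFactor_sq (γ : SL(2, ℤ)) (z : ℍ) :
    thetaFactor γ z ^ 2 = epsilonOdd (γ 1 1) ^ 2 * ((γ 1 0 : ℂ) * z + γ 1 1)⁻¹ := by
  rw [thetaFactor, mul_pow, mul_pow, kroneckerOdd_sq (isCoprime_row γ), rootFactor_sq, one_mul]

/-- For odd `κ` the whole slash factor is a `κ`-th power, so weights add under products without
branch corrections. -/
lemma thetaSlash_eq {κ : ℤ} (hκ : Odd κ) (γ : SL(2, ℤ)) (f : ℍ → ℂ) (z : ℍ) :
    thetaSlash κ γ f z = thetaFactor γ z ^ κ * f (γ • z) := by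
  rw [thetaSlash, cuspSlash_eq, thetaFactor, mul_zpow, mul_zpow,
    kroneckerOdd_zpow (isCoprime_row γ) hκ]
  ring

/-- The lower row of `diag(2, 1) γ diag(2, 1)⁻¹`. -/
lemma two_mul_smul {γ : SL(2, ℤ)} {c : ℤ} (hc : γ 1 0 = 2 * c) (z : ℍ) :
    2 * ((γ • z : ℍ) : ℂ) =
      ((γ 0 0 : ℂ) * (2 * z) + (2 * γ 0 1 : ℤ)) / ((c : ℂ) * (2 * z) + γ 1 1) := by
  rw [coe_smul_int, hc]
  push_cast
  rw [← mul_div_assoc]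
  congr 1 <;> ring

section
variable {r : ℕ} [NeZero r]

lemma thetaMult_eq {γ : SL(2, ℤ)} {c : ℤ} (hc : γ 1 0 = 2 * c) (z : ℍ) :
    thetaMult c (γ 1 1) * ((c : ℂ) * (2 * z) + γ 1 1) ^ (1 / 2 : ℂ) = (thetaFactor γ z)⁻¹ := by
  have h2 := kroneckerOdd_sq (isCoprime_row γ)
  have h0 : (kroneckerOdd (γ 1 0) (γ 1 1) : ℂ) ≠ 0 := by intro h; simp [h] at h2
  have : (kroneckerOdd (γ 1 0) (γ 1 1) : ℂ)⁻¹ = kroneckerOdd (γ 1 0) (γ 1 1) := by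
    field_simp; exact h2.symm
  rw [thetaFactor, mul_inv, mul_inv, rootFactor_inv, this, thetaMult, hc]
  push_cast
  congr 2
  ring

/-- Passing to `2z` halves the lower left entry, so `4r²` leaves the required `2r²`. The variable
`w` is kept for differentiation at `0`. -/
lemma twistedTheta_smul_zero (ψ : DirichletCharacter ℂ r) {γ : SL(2, ℤ)}
    (hγ : (4 * (r : ℤ) ^ 2) ∣ γ 1 0) (z : ℍ) (w : ℂ) :
    twistedTheta ψ (w / ((γ 1 0 : ℂ) * z + γ 1 1)) (2 * ((γ • z : ℍ) : ℂ)) =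
      (thetaFactor γ z)⁻¹ * Complex.exp (π * I * (γ 1 0 / 2) * w ^ 2 / ((γ 1 0 : ℂ) * z + γ 1 1)) *
        (ψ (γ 1 1 : ℤ) * twistedTheta ψ w (2 * z)) := by
  obtain ⟨t, ht⟩ := hγ
  have hc : γ 1 0 = 2 * (2 * (r : ℤ) ^ 2 * t) := by rw [ht]; ring
  have hdet := det_int γ
  have hj : (γ 1 0 : ℂ) * z + γ 1 1 = ((2 * (r : ℤ) ^ 2 * t : ℤ) : ℂ) * (2 * z) + γ 1 1 := by
    rw [hc]; push_cast; ring
  have hhalf : (γ 1 0 : ℂ) / 2 = ((2 * (r : ℤ) ^ 2 * t : ℤ) : ℂ) := by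
    rw [hc]; push_cast; ring
  have hpos : 0 < (2 * ((γ • z : ℍ) : ℂ)).im := two_mul_im_pos _
  rw [two_mul_smul hc] at hpos ⊢
  rw [hj, hhalf, twistedTheta_smul (ψ : ZMod r → ℂ) (by linear_combination hdet + γ 0 1 * hc)
    (even_two_mul _) (Dvd.intro t rfl) w (two_mul_im_pos z) hpos, thetaMult_eq hc]
  congr 1
  rw [twistedTheta, twistedTheta, ← tsum_mul_left]
  refine tsum_congr fun n => ?_
  rw [map_mul]
  ring

end

theorem theta0_smul {N₀ : ℕ} [NeZero N₀] {ψ₀ : DirichletCharacter ℂ N₀} (hp : ψ₀.IsPrimitive)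
    (he : ψ₀.Even) {γ : SL(2, ℤ)} (hγ : (4 * (N₀ : ℤ) ^ 2) ∣ γ 1 0) (z : ℍ) :
    thetaFactor γ z * theta0 ψ₀ (γ • z) = ψ₀ (γ 1 1 : ℤ) * theta0 ψ₀ z := by
  have := twistedTheta_smul_zero ψ₀ hγ z 0
  rw [zero_div] at this
  rw [theta0_eq hp he, theta0_eq hp he, this]
  have := thetaFactor_ne_zero γ z
  field_simp
  simp

/-- Differentiate the law in `w` at `0`: the Gaussian factor is stationary there, and the inner
derivative `1/j` supplies the extra weight 1. Rewriting `j⁻¹` through `thetaFactor_sq` produces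
`ε_d²`. -/
theorem theta1_smul {N₁ : ℕ} [NeZero N₁] {ψ₁ : DirichletCharacter ℂ N₁}
    (ho : ψ₁.Odd) {γ : SL(2, ℤ)} (hγ : (4 * (N₁ : ℤ) ^ 2) ∣ γ 1 0) (z : ℍ) :
    thetaFactor γ z ^ 3 * theta1 ψ₁ (γ • z) =
      epsilonOdd (γ 1 1) ^ 2 * ψ₁ (γ 1 1 : ℤ) * theta1 ψ₁ z := by
  set j := (γ 1 0 : ℂ) * z + γ 1 1 with hj
  have hj0 : j ≠ 0 := denom_int_ne_zero γ z
  have hl : HasDerivAt (fun w : ℂ => twistedTheta ψ₁ (w / j) (2 * ((γ • z : ℍ) : ℂ)))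
      (twistedTheta' ψ₁ 0 (2 * ((γ • z : ℍ) : ℂ)) * (1 / j)) 0 := by
    have h1 := hasDerivAt_twistedTheta ψ₁ (0 / j) (two_mul_im_pos (γ • z))
    have := h1.comp (0 : ℂ) ((hasDerivAt_id (0 : ℂ)).div_const j)
    rwa [zero_div] at this
  have hr : HasDerivAt (fun w : ℂ => (thetaFactor γ z)⁻¹ *
      Complex.exp (π * I * (γ 1 0 / 2) * w ^ 2 / j) *
        (ψ₁ (γ 1 1 : ℤ) * twistedTheta ψ₁ w (2 * z)))
      ((thetaFactor γ z)⁻¹ * (ψ₁ (γ 1 1 : ℤ) * twistedTheta' ψ₁ 0 (2 * z))) 0 := by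
    have h1 := (hasDerivAt_twistedTheta ψ₁ 0 (two_mul_im_pos z)).const_mul (ψ₁ (γ 1 1 : ℤ))
    have h2 : HasDerivAt (fun w : ℂ => Complex.exp (π * I * (γ 1 0 / 2) * w ^ 2 / j)) 0 0 := by
      have := ((((hasDerivAt_pow 2 (0 : ℂ)).const_mul (π * I * (γ 1 0 / 2))).div_const j)).cexp
      simpa using this
    have := (h2.const_mul (thetaFactor γ z)⁻¹).fun_mul h1
    simpa using this
  have e : (fun w : ℂ => twistedTheta ψ₁ (w / j) (2 * ((γ • z : ℍ) : ℂ))) = fun w : ℂ =>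
      (thetaFactor γ z)⁻¹ * Complex.exp (π * I * (γ 1 0 / 2) * w ^ 2 / j) *
        (ψ₁ (γ 1 1 : ℤ) * twistedTheta ψ₁ w (2 * z)) :=
    funext fun w => twistedTheta_smul_zero ψ₁ hγ z w
  rw [e] at hl
  have key := hl.unique hr
  have hsq := thetaFactor_sq γ z
  rw [← hj] at hsq
  have hF := thetaFactor_ne_zero γ z
  rw [theta1_eq ho, theta1_eq ho]
  have k2 : thetaFactor γ z ^ 3 * twistedTheta' ψ₁ 0 (2 * ((γ • z : ℍ) : ℂ)) =
      epsilonOdd (γ 1 1) ^ 2 * ψ₁ (γ 1 1 : ℤ) * twistedTheta' ψ₁ 0 (2 * z) := by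
    calc _ = thetaFactor γ z ^ 2 * thetaFactor γ z * j *
          (twistedTheta' ψ₁ 0 (2 * ((γ • z : ℍ) : ℂ)) * (1 / j)) := by field_simp
      _ = _ := by rw [key, hsq]; field_simp
  rw [mul_div_assoc', k2, mul_div_assoc]

/-! ### Theta functions with characteristics -/

/-- The theta function with characteristics `α`, `β`. -/
def thetaChar (α β : ℚ) (w τ : ℂ) : ℂ :=
  Complex.exp (π * I * α ^ 2 * τ + 2 * π * I * α * (w + β)) * jacobiTheta₂ (w + β + α * τ) τ

/-- `thetaChar α β` is mapped by `γ` to a multiple of a theta function with characteristics. -/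
def MapsThetaChar (γ : SL(2, ℤ)) : Prop :=
  ∀ α β : ℚ, ∃ α' β' : ℚ, ∃ C : ℂ, ∀ (w : ℂ) (z : ℍ),
    thetaChar α β (w / ((γ 1 0 : ℂ) * z + γ 1 1)) (γ • z : ℍ) =
      C * (rootFactor γ z)⁻¹ * Complex.exp (π * I * γ 1 0 * w ^ 2 / ((γ 1 0 : ℂ) * z + γ 1 1)) *
        thetaChar α' β' w z

lemma continuous_rootFactor (γ : SL(2, ℤ)) : Continuous (rootFactor γ) := by
  unfold rootFactor
  rcases eq_or_ne (γ 1 0) 0 with h | h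
  · simp only [h, Int.cast_zero, zero_mul, zero_add]
    exact continuous_const
  · refine Continuous.cpow (by fun_prop) continuous_const fun z => ?_
    rw [mem_slitPlane_iff]
    right
    rw [linear_im]
    exact mul_ne_zero (by exact_mod_cast h) z.im_pos.ne'

lemma mul_row (γ δ : SL(2, ℤ)) :
    (γ * δ) 1 0 = γ 1 0 * δ 0 0 + γ 1 1 * δ 1 0 ∧ (γ * δ) 1 1 = γ 1 0 * δ 0 1 + γ 1 1 * δ 1 1 := by
  simp [Matrix.SpecialLinearGroup.coe_mul, Matrix.mul_apply, Fin.sum_univ_two]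

lemma denom_int_mul (γ δ : SL(2, ℤ)) (z : ℍ) :
    ((γ * δ) 1 0 : ℂ) * z + ((γ * δ) 1 1 : ℤ) =
      ((γ 1 0 : ℂ) * (δ • z : ℍ) + γ 1 1) * ((δ 1 0 : ℂ) * z + δ 1 1) := by
  have := denom_int_ne_zero δ z
  rw [(mul_row γ δ).1, (mul_row γ δ).2, coe_smul_int δ z, add_mul, mul_assoc,
    div_mul_cancel₀ _ this]
  push_cast
  ring

/-- Both sides have equal squares and do not vanish, so on the connected `ℍ` they differ by a
constant sign. -/
lemma rootFactor_mul (γ δ : SL(2, ℤ)) :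
    ∃ ε : ℂ, ∀ z : ℍ,
      (rootFactor γ (δ • z))⁻¹ * (rootFactor δ z)⁻¹ = ε * (rootFactor (γ * δ) z)⁻¹ := by
  have hc : Continuous fun z : ℍ => rootFactor γ (δ • z) * rootFactor δ z :=
    ((continuous_rootFactor γ).comp (continuous_const_smul (δ : GL (Fin 2) ℝ))).mul (continuous_rootFactor δ)
  have h := IsPreconnected.eq_or_eq_neg_of_sq_eq (S := (Set.univ : Set ℍ))
    isPreconnected_univ hc.continuousOn (continuous_rootFactor (γ * δ)).continuousOn
    (fun z _ => by
      simp only [Pi.pow_apply, mul_pow, rootFactor_sq]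
      rw [denom_int_mul, mul_inv])
    (fun {z} _ => rootFactor_ne_zero (γ * δ) z)
  rcases h with h | h
  · refine ⟨1, fun z => ?_⟩
    rw [← mul_inv, one_mul]
    exact congrArg _ (h (Set.mem_univ z))
  · refine ⟨-1, fun z => ?_⟩
    have := h (Set.mem_univ z)
    simp only [Pi.neg_apply] at this
    rw [← mul_inv, this, inv_neg]
    ring

lemma MapsThetaChar.mul {γ δ : SL(2, ℤ)} (hγ : MapsThetaChar γ) (hδ : MapsThetaChar δ) :
    MapsThetaChar (γ * δ) := by
  intro α β
  obtain ⟨α₁, β₁, C₁, h₁⟩ := hγ α β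
  obtain ⟨α₂, β₂, C₂, h₂⟩ := hδ α₁ β₁
  obtain ⟨ε, hε⟩ := rootFactor_mul γ δ
  refine ⟨α₂, β₂, C₁ * C₂ * ε, fun w z => ?_⟩
  have hd := denom_int_ne_zero δ z
  have hg := denom_int_ne_zero γ (δ • z)
  have hdet : (δ 0 0 : ℂ) * δ 1 1 - δ 0 1 * δ 1 0 = 1 := by exact_mod_cast det_int δ
  -- Cocycle relation of the Gaussian factors; it rests on `det δ = 1`.
  have he : Complex.exp (π * I * γ 1 0 * (w / ((δ 1 0 : ℂ) * z + δ 1 1)) ^ 2 /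
        ((γ 1 0 : ℂ) * (δ • z : ℍ) + γ 1 1)) *
      Complex.exp (π * I * δ 1 0 * w ^ 2 / ((δ 1 0 : ℂ) * z + δ 1 1)) =
      Complex.exp (π * I * ((γ * δ) 1 0 : ℤ) * w ^ 2 /
        (((γ 1 0 : ℂ) * (δ • z : ℍ) + γ 1 1) * ((δ 1 0 : ℂ) * z + δ 1 1))) := by
    rw [← Complex.exp_add]
    congr 1
    have e : ((γ * δ) 1 0 : ℤ) = (γ 1 0 : ℂ) / ((δ 1 0 : ℂ) * z + δ 1 1) +
        δ 1 0 * ((γ 1 0 : ℂ) * (δ • z : ℍ) + γ 1 1) := by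
      rw [(mul_row γ δ).1, coe_smul_int δ z]
      field_simp
      push_cast
      linear_combination (γ 1 0 : ℂ) * hdet
    rw [e]
    field_simp
  rw [denom_int_mul, mul_smul, mul_comm (_ + _) (_ + _), ← div_div, h₁, h₂,
    mul_comm (_ + _) (_ + _), ← he]
  linear_combination (C₁ * C₂ * Complex.exp (π * I * γ 1 0 * (w / ((δ 1 0 : ℂ) * z + δ 1 1)) ^ 2 /
        ((γ 1 0 : ℂ) * (δ • z : ℍ) + γ 1 1)) *
      Complex.exp (π * I * δ 1 0 * w ^ 2 / ((δ 1 0 : ℂ) * z + δ 1 1)) *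
        thetaChar α₂ β₂ w z) * hε z

/-- `n² ≡ n` modulo 2, so the phase `exp(πi n² s)` is `exp(πi n)`. -/
lemma jacobiTheta₂_add_unit {s : ℤ} (hs : s = 1 ∨ s = -1) (w τ : ℂ) :
    jacobiTheta₂ w (τ + s) = jacobiTheta₂ (w + 1 / 2) τ := by
  refine tsum_congr fun n => ?_
  rw [jacobiTheta₂_term, jacobiTheta₂_term, Complex.exp_eq_exp_iff_exists_int]
  obtain ⟨k, hk⟩ : Even (n ^ 2 * s - n) := by
    rcases hs with rfl | rfl <;> simp [Int.even_sub, Int.even_pow]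
  refine ⟨k, ?_⟩
  have hk' : (n : ℂ) ^ 2 * s - n = k + k := by exact_mod_cast hk
  linear_combination π * I * hk'

lemma mapsThetaChar_translation {γ : SL(2, ℤ)} {s : ℤ} (hs : s = 1 ∨ s = -1) (h0 : γ 0 0 = 1)
    (h1 : γ 0 1 = s) (h2 : γ 1 0 = 0) (h3 : γ 1 1 = 1) : MapsThetaChar γ := by
  intro α β
  refine ⟨α, β + α * s + 1 / 2, Complex.exp (π * I * α ^ 2 * s - 2 * π * I * α * (α * s + 1 / 2)),
    fun w z => ?_⟩
  have hr : rootFactor γ z = 1 := by simp [rootFactor, h2, h3]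
  have hz : ((γ • z : ℍ) : ℂ) = z + s := by
    rw [coe_smul_int, h0, h1, h2, h3]; simp
  rw [hr, hz, thetaChar, thetaChar, jacobiTheta₂_add_unit hs, h2, h3]
  push_cast
  rw [zero_mul, zero_add, div_one, inv_one, mul_one, mul_zero, zero_mul, div_one, Complex.exp_zero,
    mul_one, ← mul_assoc, ← Complex.exp_add,
    show w + β + α * (z + s) + 1 / 2 = w + (β + α * s + 1 / 2) + α * z by ring]
  congr 2
  ring

lemma mapsThetaChar_S : MapsThetaChar ModularGroup.S := by
  intro α β
  -- Inversion exchanges the characteristics, as Poisson summation exchanges shifts and phases.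
  refine ⟨β, -α, Complex.exp (2 * π * I * α * β) * (-I) ^ (1 / 2 : ℂ), fun w z => ?_⟩
  have hz0 : (z : ℂ) ≠ 0 := z.ne_zero
  have h00 : ModularGroup.S 0 0 = 0 := rfl
  have h01 : ModularGroup.S 0 1 = -1 := rfl
  have h10 : ModularGroup.S 1 0 = 1 := rfl
  have h11 : ModularGroup.S 1 1 = 0 := rfl
  have hS : ((ModularGroup.S • z : ℍ) : ℂ) = -1 / z := by
    rw [coe_smul_int, h00, h01, h10, h11]; simp
  have hr : (-I * z) ^ (1 / 2 : ℂ) = (-I) ^ (1 / 2 : ℂ) * (z : ℂ) ^ (1 / 2 : ℂ) := by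
    apply mul_cpow_half_of_arg_add_mem (by simp) hz0
    rw [arg_neg_I]
    have := arg_pos_of_im_pos z.im_pos
    have := arg_le_pi (z : ℂ)
    constructor <;> linarith [pi_pos]
  have hne : (-I * z) ^ (1 / 2 : ℂ) ≠ 0 := by
    rw [Ne, cpow_eq_zero_iff, not_and_or]
    exact Or.inl (mul_ne_zero (by simp) hz0)
  have fe := jacobiTheta₂_functional_equation (w + β * z - α) z
  rw [rootFactor_inv, hS, h10, h11]
  simp only [Int.cast_one, Int.cast_zero, one_mul, add_zero, mul_one]
  rw [mul_assoc (Complex.exp _), ← hr, thetaChar, thetaChar]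
  push_cast
  rw [show w + -(α : ℂ) + β * z = w + β * z - α by ring, fe,
    show w / (z : ℂ) + β + α * (-1 / z) = (w + β * z - α) / z by field_simp; ring]
  have he : Complex.exp (π * I * α ^ 2 * (-1 / z) + 2 * π * I * α * (w / z + β)) =
      Complex.exp (2 * π * I * α * β) * Complex.exp (π * I * w ^ 2 / z) *
      Complex.exp (π * I * β ^ 2 * z + 2 * π * I * β * (w + -α)) *
      Complex.exp (-π * I * (w + β * z - α) ^ 2 / z) := by
    rw [← Complex.exp_add, ← Complex.exp_add, ← Complex.exp_add]
    congr 1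
    field_simp
    ring
  rw [he]
  field_simp

theorem mapsThetaChar (γ : SL(2, ℤ)) : MapsThetaChar γ := by
  have hγ : γ ∈ Subgroup.closure {ModularGroup.S, ModularGroup.T} := by
    rw [SpecialLinearGroup.SL2Z_generators]; exact Subgroup.mem_top γ
  have hT : MapsThetaChar ModularGroup.T :=
    mapsThetaChar_translation (s := 1) (Or.inl rfl) rfl rfl rfl rfl
  have hT' : MapsThetaChar ModularGroup.T⁻¹ := by
    apply mapsThetaChar_translation (s := -1) (Or.inr rfl) <;> simp
  -- Closure under inverses is not evident from the definition, so the inverse generators are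
  -- treated directly, here by `S⁻¹ = S³`.
  have hS' : MapsThetaChar ModularGroup.S⁻¹ := by
    have : ModularGroup.S⁻¹ = ModularGroup.S * ModularGroup.S * ModularGroup.S := by
      decide
    rw [this]
    exact (mapsThetaChar_S.mul mapsThetaChar_S).mul mapsThetaChar_S
  refine Subgroup.closure_induction'' (p := fun γ _ => MapsThetaChar γ) ?_ ?_ ?_ ?_ hγ
  · rintro x (rfl | rfl)
    exacts [mapsThetaChar_S, hT]
  · rintro x (rfl | rfl)
    exacts [hS', hT']
  · rw [← mul_inv_cancel ModularGroup.T]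
    exact hT.mul hT'
  · intro x y _ _ hx hy
    exact hx.mul hy

/-! ### Meromorphy at the cusps -/

lemma exists_meromorphicAt_mul {M k : ℕ} (hM : 0 < M) (hk : 0 < k) {F : ℂ → ℂ}
    (hF : MeromorphicAt F 0) :
    ∃ G : ℂ → ℂ, MeromorphicAt G 0 ∧ ∀ z : ℍ,
      F (Complex.exp (2 * π * I * z / M)) = G (Complex.exp (2 * π * I * z / (M * k : ℕ))) := by
  refine ⟨fun x => F (x ^ k), ?_, fun z => ?_⟩
  · have h0 : MeromorphicAt F ((fun x : ℂ => x ^ k) 0) := by simpa [hk.ne'] using hF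
    exact MeromorphicAt.comp_analyticAt (g := fun x : ℂ => x ^ k) h0 (by fun_prop)
  · have : (M : ℂ) ≠ 0 := by exact_mod_cast hM.ne'
    have : (k : ℂ) ≠ 0 := by exact_mod_cast hk.ne'
    simp only
    rw [← Complex.exp_nat_mul]
    congr 2
    push_cast
    field_simp

lemma IsMeromorphicAtInfty.exists_common {f g : ℍ → ℂ} (hf : IsMeromorphicAtInfty f)
    (hg : IsMeromorphicAtInfty g) : ∃ M : ℕ, 0 < M ∧ ∃ F G : ℂ → ℂ,
      MeromorphicAt F 0 ∧ MeromorphicAt G 0 ∧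
      (∀ z : ℍ, f z = F (Complex.exp (2 * π * I * z / M))) ∧
      ∀ z : ℍ, g z = G (Complex.exp (2 * π * I * z / M)) := by
  obtain ⟨M, hM, F, hF, hfF⟩ := hf
  obtain ⟨K, hK, G, hG, hgG⟩ := hg
  obtain ⟨F', hF', hFF'⟩ := exists_meromorphicAt_mul hM hK hF
  obtain ⟨G', hG', hGG'⟩ := exists_meromorphicAt_mul hK hM hG
  refine ⟨M * K, Nat.mul_pos hM hK, F', G', hF', hG', fun z => by rw [hfF, hFF'], fun z => ?_⟩
  rw [hgG, hGG', mul_comm K M]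

lemma IsMeromorphicAtInfty.add {f g : ℍ → ℂ} (hf : IsMeromorphicAtInfty f)
    (hg : IsMeromorphicAtInfty g) : IsMeromorphicAtInfty fun z => f z + g z := by
  obtain ⟨M, hM, F, G, hF, hG, hfF, hgG⟩ := hf.exists_common hg
  exact ⟨M, hM, F + G, hF.add hG, fun z => congrArg₂ (· + ·) (hfF z) (hgG z)⟩

lemma IsMeromorphicAtInfty.mul {f g : ℍ → ℂ} (hf : IsMeromorphicAtInfty f)
    (hg : IsMeromorphicAtInfty g) : IsMeromorphicAtInfty fun z => f z * g z := by
  obtain ⟨M, hM, F, G, hF, hG, hfF, hgG⟩ := hf.exists_common hg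
  exact ⟨M, hM, F * G, hF.mul hG, fun z => congrArg₂ (· * ·) (hfF z) (hgG z)⟩

lemma IsMeromorphicAtInfty.zpow {f : ℍ → ℂ} (hf : IsMeromorphicAtInfty f) (n : ℤ) :
    IsMeromorphicAtInfty fun z => f z ^ n := by
  obtain ⟨M, hM, F, hF, hfF⟩ := hf
  exact ⟨M, hM, F ^ n, hF.zpow n, fun z => congrArg (· ^ n) (hfF z)⟩

lemma isMeromorphicAtInfty_const (C : ℂ) : IsMeromorphicAtInfty fun _ => C :=
  ⟨1, one_pos, fun _ => C, MeromorphicAt.const C 0, fun _ => rfl⟩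

lemma isMeromorphicAtInfty_sum {ι : Type*} (s : Finset ι) {f : ι → ℍ → ℂ}
    (h : ∀ i ∈ s, IsMeromorphicAtInfty (f i)) :
    IsMeromorphicAtInfty fun z => ∑ i ∈ s, f i z := by
  classical
  induction s using Finset.induction_on with
  | empty => simpa using isMeromorphicAtInfty_const 0
  | insert i s hi ih =>
    simp only [Finset.sum_insert hi]
    exact (h i (Finset.mem_insert_self i s)).add
      (ih fun j hj => h j (Finset.mem_insert_of_mem hj))

/-- The derivative of `thetaChar α β · τ` at `0`. -/
def thetaChar' (α β : ℚ) (τ : ℂ) : ℂ :=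
  Complex.exp (π * I * α ^ 2 * τ + 2 * π * I * α * β) *
    (2 * π * I * α * jacobiTheta₂ (β + α * τ) τ + jacobiTheta₂' (β + α * τ) τ)

lemma hasDerivAt_thetaChar (α β : ℚ) {τ : ℂ} (hτ : 0 < τ.im) :
    HasDerivAt (fun w => thetaChar α β w τ) (thetaChar' α β τ) 0 := by
  have h1 : HasDerivAt (fun w : ℂ => Complex.exp (π * I * α ^ 2 * τ + 2 * π * I * α * (w + β)))
      (Complex.exp (π * I * α ^ 2 * τ + 2 * π * I * α * (0 + β)) * (2 * π * I * α * 1)) 0 :=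
    ((((hasDerivAt_id (0 : ℂ)).add_const (β : ℂ)).const_mul (2 * π * I * α)).const_add _).cexp
  have h2 : HasDerivAt (fun w : ℂ => jacobiTheta₂ (w + β + α * τ) τ)
      (jacobiTheta₂' (0 + (β + α * τ)) τ) 0 := by
    simp only [add_assoc]
    exact (hasDerivAt_jacobiTheta₂_fst _ hτ).comp_add_const 0 _
  have := h1.fun_mul h2
  convert! this using 1
  rw [thetaChar']
  simp only [zero_add]
  ring

/-- The summands of `thetaChar α β 0`. -/
def thetaCharTerm (α β : ℚ) (n : ℤ) (τ : ℂ) : ℂ :=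
  Complex.exp (π * I * (n + α) ^ 2 * τ + 2 * π * I * (n + α) * β)

lemma thetaCharTerm_eq (α β : ℚ) (n : ℤ) (τ : ℂ) :
    thetaCharTerm α β n τ = Complex.exp (π * I * α ^ 2 * τ + 2 * π * I * α * β) *
      jacobiTheta₂_term n (β + α * τ) τ := by
  rw [thetaCharTerm, jacobiTheta₂_term, ← Complex.exp_add]
  congr 1
  ring

lemma hasSum_thetaCharTerm (α β : ℚ) {τ : ℂ} (hτ : 0 < τ.im) :
    HasSum (fun n => thetaCharTerm α β n τ) (thetaChar α β 0 τ) := by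
  simp only [thetaCharTerm_eq, thetaChar, zero_add]
  exact (hasSum_jacobiTheta₂_term _ hτ).mul_left _

lemma hasSum_thetaCharTerm' (α β : ℚ) {τ : ℂ} (hτ : 0 < τ.im) :
    HasSum (fun n : ℤ => 2 * π * I * (n + α) * thetaCharTerm α β n τ) (thetaChar' α β τ) := by
  have := (((hasSum_jacobiTheta₂_term (β + α * τ) hτ).mul_left (2 * π * I * α)).add
    (hasSum_jacobiTheta₂'_term (β + α * τ) hτ)).mul_left
      (Complex.exp (π * I * α ^ 2 * τ + 2 * π * I * α * β))
  refine this.congr_fun fun n => ?_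
  rw [thetaCharTerm_eq, jacobiTheta₂'_term]
  ring

lemma isMeromorphicAtInfty_of_hasSum {a : ℤ → ℂ} {α β : ℚ} {A B E : ℕ} (hE : 0 < E)
    (hA : 0 < A) {g : ℂ → ℂ}
    (h : ∀ τ : ℂ, 0 < τ.im → HasSum (fun n => a n * thetaCharTerm α β n τ) (g τ)) :
    IsMeromorphicAtInfty fun z => g ((A * z + B) / E) := by
  -- This `M` clears the denominators of `(n + α)² A / (2E)`, leaving natural exponents.
  have hM : 0 < 2 * α.den ^ 2 * E := by have := α.den_pos; positivity
  have hterm : ∀ (z : ℍ) (n : ℤ), a n * thetaCharTerm α β n ((A * z + B) / E) =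
      a n * Complex.exp (π * I * (n + α) ^ 2 * (B / E) + 2 * π * I * (n + α) * β) *
        Complex.exp (2 * π * I * z / (2 * α.den ^ 2 * E : ℕ)) ^
          ((n * α.den + α.num).natAbs ^ 2 * A) := by
    intro z n
    rw [mul_assoc, thetaCharTerm, ← Complex.exp_nat_mul, ← Complex.exp_add]
    congr 2
    have h1 : (((n * α.den + α.num).natAbs : ℂ)) ^ 2 = ((n : ℂ) * α.den + α.num) ^ 2 := by
      have := congrArg (Int.cast (R := ℂ)) (Int.natAbs_sq (n * α.den + α.num))
      push_cast at this
      rwa [Nat.cast_natAbs]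
    have h2 : (α : ℂ) = α.num / α.den := by exact_mod_cast (Rat.num_div_den α).symm
    have h3 : (α.den : ℂ) ≠ 0 := by exact_mod_cast α.den_nz
    have h4 : (E : ℂ) ≠ 0 := by exact_mod_cast hE.ne'
    push_cast
    rw [h1, h2]
    field_simp
    ring
  have him : ∀ z : ℍ, 0 < (((A : ℂ) * z + B) / E).im := fun z => by
    have : ((A : ℂ) * z + B) / E = ((A / E : ℝ) : ℂ) * z + ((B / E : ℝ) : ℂ) := by
      push_cast; ring
    rw [this, add_im, im_ofReal_mul, ofReal_im, add_zero]
    have := z.im_pos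
    have : (0 : ℝ) < A := by exact_mod_cast hA
    have : (0 : ℝ) < E := by exact_mod_cast hE
    rw [coe_im]
    positivity
  obtain ⟨F, hF, hFs⟩ := exists_differentiableOn_ball_of_summable _ _ hM fun z =>
    (h _ (him z)).summable.congr (hterm z)
  refine isMeromorphicAtInfty_of_differentiableOn_ball hM hF fun z => ?_
  rw [← hFs z, ← (h _ (him z)).tsum_eq]
  exact tsum_congr (hterm z)

lemma exists_SL2_of_det_eq_one {a b c d : ℤ} (h : a * d - b * c = 1) :
    ∃ γ : SL(2, ℤ), γ 0 0 = a ∧ γ 0 1 = b ∧ γ 1 0 = c ∧ γ 1 1 = d :=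
  ⟨⟨!![a, b; c, d], by rw [Matrix.det_fin_two_of, h]⟩, rfl, rfl, rfl, rfl⟩

/-- A Hermite decomposition of `diag(2, 1) γ`. -/
lemma exists_two_mul_smul_eq (γ : SL(2, ℤ)) :
    ∃ (γ' : SL(2, ℤ)) (A B E : ℕ) (K : ℂ), 0 < A ∧ 0 < E ∧ ∀ z : ℍ, ∃ w : ℍ,
      (w : ℂ) = (A * z + B) / E ∧ 2 * ((γ • z : ℍ) : ℂ) = (γ' • w : ℍ) ∧
      (γ' 1 0 : ℂ) * w + γ' 1 1 = ((γ 1 0 : ℂ) * z + γ 1 1) / E ∧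
      (rootFactor γ' w)⁻¹ = K * (rootFactor γ z)⁻¹ := by
  have hdet := det_int γ
  rcases Int.even_or_odd' (γ 1 0) with ⟨c, hc | hc⟩
  · obtain ⟨γ', h00, h01, h10, h11⟩ := exists_SL2_of_det_eq_one
      (show γ 0 0 * γ 1 1 - 2 * γ 0 1 * c = 1 by linear_combination hdet + γ 0 1 * hc)
    refine ⟨γ', 2, 0, 1, 1, two_pos, one_pos, fun z => ⟨⟨2 * z, two_mul_im_pos z⟩, by simp, ?_⟩⟩
    have hj : (c : ℂ) * (2 * z) + γ 1 1 = (γ 1 0 : ℂ) * z + γ 1 1 := by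
      rw [hc]; push_cast; ring
    refine ⟨?_, ?_, ?_⟩
    · rw [two_mul_smul hc, coe_smul_int, h00, h01, h10, h11]
    · simp only [h10, h11, hj, Nat.cast_one, div_one]
    · simp only [rootFactor_inv, h10, h11, hj, one_mul]
  -- For odd `c`, choose `B` in `{0, 1}` with `d ≡ cB` modulo 2; then `diag(2, 1) γ = γ' (1 B; 0
  -- 2)`.
  · obtain ⟨B, e, hB⟩ : ∃ (B : ℕ) (e : ℤ), γ 1 1 = γ 1 0 * B + 2 * e := by
      rcases Int.even_or_odd' (γ 1 1) with ⟨d, hd | hd⟩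
      · exact ⟨0, d, by simp [hd]⟩
      · exact ⟨1, d - c, by rw [hc, hd]; push_cast; ring⟩
    obtain ⟨γ', h00, h01, h10, h11⟩ := exists_SL2_of_det_eq_one
      (show 2 * γ 0 0 * e - (γ 0 1 - γ 0 0 * B) * γ 1 0 = 1 by
        linear_combination hdet - γ 0 0 * hB)
    have hB' : (γ 1 1 : ℂ) = γ 1 0 * B + 2 * e := by exact_mod_cast hB
    refine ⟨γ', 1, B, 2, (1 / 2 : ℂ) ^ (1 / 2 : ℂ), one_pos, two_pos, fun z => ?_⟩
    have him : 0 < (((z : ℂ) + B) / 2).im := by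
      have : ((z : ℂ) + B) / 2 = ((1 / 2 : ℝ) : ℂ) * z + ((B / 2 : ℝ) : ℂ) := by
        push_cast; ring
      rw [this, add_im, im_ofReal_mul, ofReal_im, add_zero]
      have := z.im_pos
      rw [coe_im]
      positivity
    have hj : (γ 1 0 : ℂ) * (((z : ℂ) + B) / 2) + e = ((γ 1 0 : ℂ) * z + γ 1 1) / 2 := by
      rw [hB']; ring
    refine ⟨⟨((z : ℂ) + B) / 2, him⟩, by simp, ?_, ?_, ?_⟩
    · rw [coe_smul_int, coe_smul_int]
      simp only [h00, h01, h10, h11, hj]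
      have := denom_int_ne_zero γ z
      push_cast
      field_simp
      ring
    · simp only [h10, h11, hj, Nat.cast_ofNat]
    · simp only [rootFactor_inv, h10, h11, hj]
      rw [div_eq_mul_one_div, mul_comm]
      apply mul_cpow_half_of_arg_add_mem (by norm_num) (denom_int_ne_zero γ z)
      have : arg (1 / 2 : ℂ) = 0 := by
        rw [arg_eq_zero_iff]; norm_num
      rw [this, zero_add]
      exact ⟨neg_pi_lt_arg _, arg_le_pi _⟩

section
variable {r : ℕ} [NeZero r]

lemma thetaChar_zero_left (β : ℚ) (w τ : ℂ) :
    thetaChar 0 β w τ = jacobiTheta₂ (w + β) τ := by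
  simp [thetaChar]

lemma thetaChar'_zero_left (β : ℚ) (τ : ℂ) : thetaChar' 0 β τ = jacobiTheta₂' β τ := by
  simp [thetaChar']

lemma MapsThetaChar.zero {γ : SL(2, ℤ)} (hγ : MapsThetaChar γ) (α β : ℚ) :
    ∃ α' β' : ℚ, ∃ C : ℂ, ∀ z : ℍ,
      thetaChar α β 0 (γ • z : ℍ) = C * (rootFactor γ z)⁻¹ * thetaChar α' β' 0 z ∧
      thetaChar' α β (γ • z : ℍ) = C * (rootFactor γ z)⁻¹ *
        ((γ 1 0 : ℂ) * z + γ 1 1) * thetaChar' α' β' z := by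
  obtain ⟨α', β', C, h⟩ := hγ α β
  refine ⟨α', β', C, fun z => ⟨by simpa using h 0 z, ?_⟩⟩
  set j := (γ 1 0 : ℂ) * z + γ 1 1 with hj
  have hj0 : j ≠ 0 := denom_int_ne_zero γ z
  have hl : HasDerivAt (fun w : ℂ => thetaChar α β (w / j) (γ • z : ℍ))
      (thetaChar' α β (γ • z : ℍ) * (1 / j)) 0 := by
    have h1 := hasDerivAt_thetaChar α β (γ • z).im_pos
    rw [← zero_div j] at h1
    exact h1.comp (0 : ℂ) ((hasDerivAt_id (0 : ℂ)).div_const j)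
  have hr : HasDerivAt (fun w : ℂ => C * (rootFactor γ z)⁻¹ *
      Complex.exp (π * I * γ 1 0 * w ^ 2 / j) * thetaChar α' β' w z)
      (C * (rootFactor γ z)⁻¹ * thetaChar' α' β' z) 0 := by
    have h1 := hasDerivAt_thetaChar α' β' z.im_pos
    have h2 : HasDerivAt (fun w : ℂ => Complex.exp (π * I * γ 1 0 * w ^ 2 / j)) 0 0 := by
      have := ((((hasDerivAt_pow 2 (0 : ℂ)).const_mul (π * I * γ 1 0)).div_const j)).cexp
      simpa using this
    have := (h2.const_mul (C * (rootFactor γ z)⁻¹)).fun_mul h1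
    simpa using this
  rw [funext fun w => h w z] at hl
  have key := hl.unique hr
  field_simp at key ⊢
  rw [key]

lemma twistedTheta_zero_eq_sum (φ : ZMod r → ℂ) {τ : ℂ} (hτ : 0 < τ.im) :
    twistedTheta φ 0 τ =
      ∑ u : ZMod r, fourierCoeff φ u * thetaChar 0 (u.val / r : ℚ) 0 τ := by
  rw [twistedTheta_eq_sum φ 0 hτ]
  refine Finset.sum_congr rfl fun u _ => ?_
  rw [thetaChar_zero_left]
  push_cast
  rfl

lemma twistedTheta'_zero_eq_sum (φ : ZMod r → ℂ) {τ : ℂ} (hτ : 0 < τ.im) :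
    twistedTheta' φ 0 τ =
      ∑ u : ZMod r, fourierCoeff φ u * thetaChar' 0 (u.val / r : ℚ) τ := by
  rw [twistedTheta', (summable_twistedTheta' φ 0 hτ).tsum_eq]
  refine Finset.sum_congr rfl fun u _ => ?_
  rw [thetaChar'_zero_left, zero_add]
  push_cast
  rfl

/-- Expand in theta functions with characteristics and move `γ` past the doubling. The slash factors
of weights `1/2` and `3/2` cancel the automorphy factors, leaving convergent series in a local
parameter. -/
lemma isMeromorphicAtInfty_twistedTheta (φ : ZMod r → ℂ) (γ : SL(2, ℤ)) :
    IsMeromorphicAtInfty (cuspSlash 1 γ fun z => twistedTheta φ 0 (2 * z)) ∧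
    IsMeromorphicAtInfty (cuspSlash 3 γ fun z => twistedTheta' φ 0 (2 * z)) := by
  obtain ⟨γ', A, B, E, K, hA, hE, h⟩ := exists_two_mul_smul_eq γ
  have hE0 : (E : ℂ) ≠ 0 := by exact_mod_cast hE.ne'
  choose α β C hC using fun u : ZMod r => (mapsThetaChar γ').zero 0 (u.val / r : ℚ)
  constructor
  · have e : cuspSlash 1 γ (fun z => twistedTheta φ 0 (2 * z)) = fun z : ℍ =>
        ∑ u : ZMod r, fourierCoeff φ u * C u * K * thetaChar (α u) (β u) 0 ((A * z + B) / E) := by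
      funext z
      obtain ⟨w, hw, h1, h2, h3⟩ := h z
      rw [cuspSlash_eq, h1, twistedTheta_zero_eq_sum φ (γ' • w).im_pos, Finset.mul_sum]
      refine Finset.sum_congr rfl fun u _ => ?_
      rw [(hC u w).1, h3, ← hw, zpow_one]
      have := rootFactor_ne_zero γ z
      field_simp
    rw [e]
    refine isMeromorphicAtInfty_sum _ fun u _ => (isMeromorphicAtInfty_const _).mul ?_
    refine isMeromorphicAtInfty_of_hasSum (a := fun _ => 1) (α := α u) (β := β u) hE hA
      (g := fun τ => thetaChar (α u) (β u) 0 τ) fun τ hτ => ?_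
    simpa using hasSum_thetaCharTerm (α u) (β u) hτ
  · have e : cuspSlash 3 γ (fun z => twistedTheta' φ 0 (2 * z)) = fun z : ℍ =>
        ∑ u : ZMod r, fourierCoeff φ u * C u * K / E *
          thetaChar' (α u) (β u) ((A * z + B) / E) := by
      funext z
      obtain ⟨w, hw, h1, h2, h3⟩ := h z
      rw [cuspSlash_eq, h1, twistedTheta'_zero_eq_sum φ (γ' • w).im_pos, Finset.mul_sum]
      refine Finset.sum_congr rfl fun u _ => ?_
      have hs := rootFactor_sq γ z
      have hj := denom_int_ne_zero γ z
      have hr := rootFactor_ne_zero γ z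
      rw [(hC u w).2, h3, ← hw, h2, show (3 : ℤ) = (2 : ℕ) + 1 by norm_num, zpow_add₀ hr,
        zpow_natCast, hs, zpow_one]
      field_simp
    rw [e]
    refine isMeromorphicAtInfty_sum _ fun u _ => (isMeromorphicAtInfty_const _).mul ?_
    exact isMeromorphicAtInfty_of_hasSum (a := fun n => 2 * π * I * (n + α u)) hE hA
      (g := fun τ => thetaChar' (α u) (β u) τ) fun τ hτ => hasSum_thetaCharTerm' (α u) (β u) hτ

end

theorem isMeromorphicAtInfty_theta0 {N₀ : ℕ} [NeZero N₀] {ψ₀ : DirichletCharacter ℂ N₀}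
    (hp : ψ₀.IsPrimitive) (he : ψ₀.Even) (γ : SL(2, ℤ)) :
    IsMeromorphicAtInfty (cuspSlash 1 γ (theta0 ψ₀)) := by
  have := (isMeromorphicAtInfty_const (1 / 2)).mul (isMeromorphicAtInfty_twistedTheta ψ₀ γ).1
  convert! this using 2 with z
  rw [cuspSlash_eq, cuspSlash_eq, theta0_eq hp he]
  ring

theorem isMeromorphicAtInfty_theta1 {N₁ : ℕ} [NeZero N₁] {ψ₁ : DirichletCharacter ℂ N₁}
    (ho : ψ₁.Odd) (γ : SL(2, ℤ)) :
    IsMeromorphicAtInfty (cuspSlash 3 γ (theta1 ψ₁)) := by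
  have := (isMeromorphicAtInfty_const (1 / (4 * π * I))).mul
    (isMeromorphicAtInfty_twistedTheta ψ₁ γ).2
  convert! this using 2 with z
  rw [cuspSlash_eq, cuspSlash_eq, theta1_eq ho]
  ring

/-! ### Derivatives at the cusps and Bol's identity -/

lemma normalizedDeriv_eq_of_eq {f : ℍ → ℂ} {G : ℂ → ℂ} (h : ∀ z : ℍ, f z = G z) (z : ℍ) :
    normalizedDerivOfComplex f z = (2 * π * I)⁻¹ * deriv G z := by
  rw [normalizedDerivOfComplex]
  congr 1
  apply Filter.EventuallyEq.deriv_eq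
  filter_upwards [isOpen_upperHalfPlaneSet.mem_nhds z.im_pos] with w hw
  rw [Function.comp_apply, h, ofComplex_apply_of_im_pos hw]

/-- A function of the local parameter that is holomorphic on the upper half-plane is
differentiable at the points of the punctured disc. -/
lemma differentiableAt_of_mdiff {g : ℍ → ℂ} (hg : MDiff g) {M : ℕ} (hM : 0 < M) {F : ℂ → ℂ}
    (h : ∀ z : ℍ, g z = F (Complex.exp (2 * π * I * z / M))) (z : ℍ) :
    DifferentiableAt ℂ F (Complex.exp (2 * π * I * z / M)) := by
  set q₀ := Complex.exp (2 * π * I * z / M) with hq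
  have hq0 : q₀ ≠ 0 := Complex.exp_ne_zero _
  have hM0 : (M : ℂ) ≠ 0 := by exact_mod_cast hM.ne'
  have hpi := two_pi_I_ne_zero
  -- A local inverse of the parameter map that sends `q₀` to `z`.
  let l : ℂ → ℂ := fun x => z + M / (2 * π * I) * Complex.log (x / q₀)
  have hl : DifferentiableAt ℂ l q₀ := by
    have : DifferentiableAt ℂ (fun x => Complex.log (x / q₀)) q₀ :=
      (differentiableAt_id.div_const q₀).clog (by simp [div_self hq0])
    exact (this.const_mul _).const_add _
  have hl0 : l q₀ = z := by simp [l, div_self hq0]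
  have hg' : DifferentiableAt ℂ (g ∘ ofComplex) (l q₀) := by
    rw [hl0]; exact UpperHalfPlane.mdifferentiableAt_iff.1 (hg z)
  refine (hg'.comp q₀ hl).congr_of_eventuallyEq ?_
  have hpos : ∀ᶠ x in 𝓝 q₀, l x ∈ upperHalfPlaneSet :=
    hl.continuousAt.eventually (isOpen_upperHalfPlaneSet.mem_nhds (by rw [hl0]; exact z.im_pos))
  filter_upwards [hpos, isOpen_ne.mem_nhds hq0] with x hx hx0
  rw [Function.comp_apply, Function.comp_apply, ofComplex_apply_of_im_pos hx, h]
  have : 2 * π * I * l x / M = 2 * π * I * z / M + Complex.log (x / q₀) := by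
    simp only [l]; field_simp
  rw [UpperHalfPlane.coe_mk, this, Complex.exp_add, ← hq, Complex.exp_log (div_ne_zero hx0 hq0),
    mul_div_cancel₀ _ hq0]

/-- In `x = e^(2πiz/M)` the operator `D` is `(x/M) d/dx`. Holomorphy of `g` is what makes `F`
differentiable at every value of `x`, not only near `0`. -/
lemma IsMeromorphicAtInfty.normalizedDeriv {g : ℍ → ℂ} (hg : MDiff g)
    (h : IsMeromorphicAtInfty g) : IsMeromorphicAtInfty (normalizedDerivOfComplex g) := by
  obtain ⟨M, hM, F, hF, hgF⟩ := h
  have hM0 : (M : ℂ) ≠ 0 := by exact_mod_cast hM.ne'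
  refine ⟨M, hM, fun x => (x / M) * deriv F x, MeromorphicAt.mul (by fun_prop) hF.deriv,
    fun z => ?_⟩
  rw [normalizedDeriv_eq_of_eq (G := fun w => F (Complex.exp (2 * π * I * w / M))) hgF]
  have h1 := (differentiableAt_of_mdiff hg hM hgF z).hasDerivAt
  have h2 : HasDerivAt (fun w : ℂ => Complex.exp (2 * π * I * w / M))
      (Complex.exp (2 * π * I * z / M) * (2 * π * I * 1 / M)) (z : ℂ) :=
    (((hasDerivAt_id (z : ℂ)).const_mul (2 * π * I)).div_const (M : ℂ)).cexp
  have h3 := h1.comp (z : ℂ) h2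
  rw [show (fun w => F (Complex.exp (2 * π * I * w / M))) =
    F ∘ fun w => Complex.exp (2 * π * I * w / M) from rfl, h3.deriv]
  have := two_pi_I_ne_zero
  field_simp

lemma bolD_succ (m : ℕ) (f : ℍ → ℂ) : bolD (m + 1) f = normalizedDerivOfComplex (bolD m f) := by
  rw [bolD, Function.iterate_succ_apply', bolD]

lemma mdiff_bolD (m : ℕ) {f : ℍ → ℂ} (hf : MDiff f) : MDiff (bolD m f) := by
  induction m with
  | zero => exact hf
  | succ m ih => rw [bolD_succ]; exact normalizedDerivOfComplex_mdifferentiable ih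

lemma IsMeromorphicAtInfty.bolD (m : ℕ) {f : ℍ → ℂ} (hf : MDiff f)
    (h : IsMeromorphicAtInfty f) : IsMeromorphicAtInfty (bolD m f) := by
  induction m with
  | zero => exact h
  | succ m ih => rw [bolD_succ]; exact ih.normalizedDeriv (mdiff_bolD m hf)

lemma mdiff_linear (c d : ℂ) : MDiff fun z : ℍ => c * z + d := by
  rw [UpperHalfPlane.mdifferentiable_iff]
  have : DifferentiableOn ℂ (fun z : ℂ => c * z + d) upperHalfPlaneSet := by fun_prop
  refine this.congr fun z hz => ?_
  rw [Function.comp_apply, ofComplex_apply_of_im_pos hz]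

lemma normalizedDeriv_linear (c d : ℂ) :
    normalizedDerivOfComplex (fun z : ℍ => c * z + d) = fun _ => (2 * π * I)⁻¹ * c := by
  funext z
  rw [normalizedDeriv_eq_of_eq (G := fun w => c * w + d) fun _ => rfl]
  simp

/-- The Leibniz rule for the product with a linear function. -/
lemma bolD_linear_mul (c d : ℂ) {u : ℍ → ℂ} (hu : MDiff u) (n : ℕ) :
    bolD (n + 1) ((fun z : ℍ => c * z + d) * u) =
      (fun z : ℍ => c * z + d) * bolD (n + 1) u + ((n + 1) * ((2 * π * I)⁻¹ * c)) • bolD n u := by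
  induction n with
  | zero =>
    have h0 : ∀ f : ℍ → ℂ, bolD 0 f = f := fun f => rfl
    rw [bolD_succ, bolD_succ, h0, h0, normalizedDerivOfComplex_mul _ _ (mdiff_linear c d) hu,
      normalizedDeriv_linear]
    ext z
    simp
    ring
  | succ n ih =>
    have m1 := mdiff_bolD (n + 1) hu
    have m0 := mdiff_bolD n hu
    rw [bolD_succ (n + 1), ih, normalizedDerivOfComplex_add _ _ ((mdiff_linear c d).mul m1)
      (m0.const_smul _), normalizedDerivOfComplex_mul _ _ (mdiff_linear c d) m1,
      normalizedDerivOfComplex_smul _ _ m0, normalizedDeriv_linear, ← bolD_succ, ← bolD_succ]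
    ext z
    simp
    ring

lemma slash_int_apply (k : ℤ) (γ : SL(2, ℤ)) (f : ℍ → ℂ) (z : ℍ) :
    (f ∣[k] γ) z = f (γ • z) * ((γ 1 0 : ℂ) * z + γ 1 1) ^ (-k) := by
  rw [ModularForm.SL_slash_apply, ModularGroup.denom_apply]

lemma linear_mul_slash (k : ℤ) (γ : SL(2, ℤ)) (f : ℍ → ℂ) :
    (fun z : ℍ => (γ 1 0 : ℂ) * z + γ 1 1) * (f ∣[k] γ) = f ∣[k - 1] γ := by
  ext z
  rw [Pi.mul_apply, slash_int_apply, slash_int_apply, show -(k - 1) = -k + 1 by ring,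
    zpow_add₀ (denom_int_ne_zero γ z), zpow_one]
  ring

/-- Bol's identity. -/
theorem bolD_slash (m : ℕ) {f : ℍ → ℂ} (hf : MDiff f) (γ : SL(2, ℤ)) :
    bolD m (f ∣[(1 - m : ℤ)] γ) = bolD m f ∣[(1 + m : ℤ)] γ := by
  induction m with
  | zero => rfl
  | succ m ih =>
    have hu : MDiff (f ∣[(1 - m : ℤ)] γ) := hf.slash _ _
    -- Lowering the weight by 1 is multiplication by `cz + d`. The extra Leibniz term `(m+1)c/(2πi)
    -- · D^m` cancels the correction in the derivative of a slash of weight `1 + m`.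
    rw [show (1 - (m + 1 : ℕ) : ℤ) = (1 - m) - 1 by push_cast; ring, ← linear_mul_slash,
      bolD_linear_mul _ _ hu, bolD_succ m (f ∣[(1 - m : ℤ)] γ), ih,
      normalizedDerivOfComplex_SL_slash (mdiff_bolD m hf), ← bolD_succ,
      show (1 + (m + 1 : ℕ) : ℤ) = (1 + m + 2) - 1 by push_cast; ring, ← linear_mul_slash]
    ext z
    have := denom_int_ne_zero γ z
    simp only [Pi.add_apply, Pi.mul_apply, Pi.sub_apply, Pi.smul_apply, smul_eq_mul, ModularGroup.denom_apply]
    push_cast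
    field_simp
    ring

/-! ### The resulting character and the assembly -/

lemma kroneckerOdd_neg_one {d : ℤ} (hd : Odd d) : kroneckerOdd (-1) d = ZMod.χ₄ (d : ZMod 4) := by
  have hd' : Odd d.natAbs := Int.natAbs_odd.2 hd
  have h2 : d % 2 = 1 := Int.odd_iff.1 hd
  unfold kroneckerOdd
  rw [jacobiSym.at_neg_one hd']
  rcases Nat.odd_mod_four_iff.1 (Nat.odd_iff.1 hd') with h | h <;> by_cases hneg : d < 0
  · rw [ZMod.χ₄_nat_one_mod_four h, ZMod.χ₄_int_three_mod_four (by omega)]; simp [hneg]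
  · rw [ZMod.χ₄_nat_one_mod_four h, ZMod.χ₄_int_one_mod_four (by omega)]; simp [hneg]
  · rw [ZMod.χ₄_nat_three_mod_four h, ZMod.χ₄_int_one_mod_four (by omega)]; simp [hneg]
  · rw [ZMod.χ₄_nat_three_mod_four h, ZMod.χ₄_int_three_mod_four (by omega)]; simp [hneg]

lemma exists_character {N₀ N₁ N : ℕ} (h₀ : N₀ ∣ N) (h₁ : N₁ ∣ N) (h₄ : 4 ∣ N)
    (ψ₀ : DirichletCharacter ℂ N₀) (ψ₁ : DirichletCharacter ℂ N₁) (ψ : DirichletCharacter ℂ N) :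
    ∃ χ : DirichletCharacter ℂ N, ∀ d : ℤ, IsCoprime d (N : ℤ) →
      χ (d : ZMod N) = ψ (d : ZMod N) * (kroneckerOdd (-1) d : ℂ) *
        (ψ₁ (d : ZMod N₁) / ψ₀ (d : ZMod N₀)) := by
  let χ₄ : DirichletCharacter ℂ 4 := ZMod.χ₄.ringHomComp (Int.castRingHom ℂ)
  refine ⟨ψ * DirichletCharacter.changeLevel h₄ χ₄ * (DirichletCharacter.changeLevel h₁ ψ₁ *
    (DirichletCharacter.changeLevel h₀ ψ₀)⁻¹), fun d hd => ?_⟩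
  have hodd : Odd d := by
    have h2 : (2 : ℤ) ∣ N := by exact_mod_cast (show 2 ∣ 4 by norm_num).trans h₄
    have := hd.of_isCoprime_of_dvd_right h2
    rw [← Int.not_even_iff_odd]
    intro he
    have := this.isUnit_of_dvd' (even_iff_two_dvd.1 he) dvd_rfl
    exact absurd (Int.isUnit_iff.1 this) (by norm_num)
  rw [MulChar.mul_apply, MulChar.mul_apply, MulChar.mul_apply, MulChar.inv_apply_eq_inv',
    DirichletCharacter.changeLevel_eq_cast_of_dvd' _ h₄ hd,
    DirichletCharacter.changeLevel_eq_cast_of_dvd' _ h₁ hd,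
    DirichletCharacter.changeLevel_eq_cast_of_dvd' _ h₀ hd, kroneckerOdd_neg_one hodd, div_eq_mul_inv]
  rfl

lemma mdiff_zpow {f : ℍ → ℂ} (hf : MDiff f) (h0 : ∀ z, f z ≠ 0) (n : ℤ) :
    MDiff fun z => f z ^ n := by
  rw [UpperHalfPlane.mdifferentiable_iff] at hf ⊢
  exact hf.zpow (Or.inl fun z _ => h0 _)

lemma bolD_const_smul (m : ℕ) (C : ℂ) {f : ℍ → ℂ} (hf : MDiff f) :
    bolD m (C • f) = C • bolD m f := by
  induction m with
  | zero => rfl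
  | succ m ih => rw [bolD_succ, ih, normalizedDerivOfComplex_smul _ _ (mdiff_bolD m hf), ← bolD_succ]

/-- The power identity behind the weights of `θ₀ ^ (1 - 3a) θ₁ ^ a f`. -/
lemma zpow_weight_inner {s : ℂ} (hs : s ≠ 0) (x y w : ℂ) (a m : ℤ) :
    s ^ (2 - 2 * m) * (x ^ (1 - 3 * a) * y ^ a * w) =
      (s * x) ^ (1 - 3 * a) * (s ^ 3 * y) ^ a * (s ^ (1 - 2 * m) * w) := by
  rw [mul_zpow, mul_zpow, ← zpow_natCast s 3, ← zpow_mul,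
    show 2 - 2 * m = (1 - 3 * a) + (3 : ℕ) * a + (1 - 2 * m) by push_cast; ring,
    zpow_add₀ hs, zpow_add₀ hs]
  ring

lemma zpow_weight_outer {s : ℂ} (hs : s ≠ 0) (x y w : ℂ) (a m : ℤ) :
    s ^ (2 * m + 3) * (x ^ (3 * a - 2) * y ^ (1 - a) * w) =
      (s * x) ^ (3 * a - 2) * (s ^ 3 * y) ^ (1 - a) * (s ^ (2 + 2 * m) * w) := by
  rw [mul_zpow, mul_zpow, ← zpow_natCast s 3, ← zpow_mul,
    show 2 * m + 3 = (3 * a - 2) + (3 : ℕ) * (1 - a) + (2 + 2 * m) by push_cast; ring,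
    zpow_add₀ hs, zpow_add₀ hs]
  ring

lemma zpow_two_mul (s : ℂ) (n : ℤ) : s ^ (2 * n) = (s ^ 2) ^ n := by
  rw [zpow_mul]; norm_cast

section
variable {N₀ N₁ : ℕ} {ψ₀ : DirichletCharacter ℂ N₀} {ψ₁ : DirichletCharacter ℂ N₁}

/-- The function of integral weight to which Bol's identity is applied. -/
def bolInner (ψ₀ : DirichletCharacter ℂ N₀) (ψ₁ : DirichletCharacter ℂ N₁) (a : ℤ) (f : ℍ → ℂ)
    (z : ℍ) : ℂ := theta0 ψ₀ z ^ (1 - 3 * a) * theta1 ψ₁ z ^ a * f z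

/-- The half-integral weights add up to the even exponent `2 - 2m`, so the square root disappears.
-/
lemma bolInner_slash (a : ℤ) (m : ℕ) (f : ℍ → ℂ) (γ : SL(2, ℤ)) (z : ℍ) :
    (bolInner ψ₀ ψ₁ a f ∣[(1 - m : ℤ)] γ) z =
      cuspSlash 1 γ (theta0 ψ₀) z ^ (1 - 3 * a) * cuspSlash 3 γ (theta1 ψ₁) z ^ a *
        cuspSlash (1 - 2 * m) γ f z := by
  have hs := rootFactor_ne_zero γ z
  have e3 : rootFactor γ z ^ (3 : ℤ) = rootFactor γ z ^ 3 := by norm_cast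
  rw [slash_int_apply, cuspSlash_eq, cuspSlash_eq, cuspSlash_eq, zpow_one, e3,
    ← zpow_weight_inner hs, show (2 : ℤ) - 2 * m = 2 * (1 - m) by ring, zpow_two_mul,
    rootFactor_sq, inv_zpow', bolInner, mul_comm]

lemma cuspSlash_bolDelta (a : ℤ) (m : ℕ) (f : ℍ → ℂ) (γ : SL(2, ℤ)) (z : ℍ) :
    cuspSlash (2 * m + 3) γ (bolDelta ψ₀ ψ₁ a m f) z =
      cuspSlash 1 γ (theta0 ψ₀) z ^ (3 * a - 2) * cuspSlash 3 γ (theta1 ψ₁) z ^ (1 - a) *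
        (bolD m (bolInner ψ₀ ψ₁ a f) ∣[(1 + m : ℤ)] γ) z := by
  have hs := rootFactor_ne_zero γ z
  have e3 : rootFactor γ z ^ (3 : ℤ) = rootFactor γ z ^ 3 := by norm_cast
  rw [slash_int_apply, cuspSlash_eq, cuspSlash_eq, cuspSlash_eq, zpow_one, e3, bolDelta,
    zpow_weight_outer hs, show (2 : ℤ) + 2 * m = 2 * (1 + m) by ring, zpow_two_mul,
    rootFactor_sq, inv_zpow', mul_comm ((_ : ℂ) ^ (-(1 + m : ℤ)))]
  rfl

variable [NeZero N₀] [NeZero N₁]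

lemma mdiff_bolInner (h₀ : ψ₀.IsPrimitive) (h₀' : ψ₀.Even) (h₁ : ψ₁.Odd)
    (hθ₀ : ∀ z, theta0 ψ₀ z ≠ 0) (hθ₁ : ∀ z, theta1 ψ₁ z ≠ 0) (a : ℤ) {f : ℍ → ℂ} (hf : MDiff f) :
    MDiff (bolInner ψ₀ ψ₁ a f) :=
  ((mdiff_zpow (mdiff_theta0 h₀ h₀') hθ₀ _).mul (mdiff_zpow (mdiff_theta1 h₁) hθ₁ _)).mul hf

lemma mdiff_bolDelta (h₀ : ψ₀.IsPrimitive) (h₀' : ψ₀.Even) (h₁ : ψ₁.Odd)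
    (hθ₀ : ∀ z, theta0 ψ₀ z ≠ 0) (hθ₁ : ∀ z, theta1 ψ₁ z ≠ 0) (a : ℤ) (m : ℕ) {f : ℍ → ℂ}
    (hf : MDiff f) : MDiff (bolDelta ψ₀ ψ₁ a m f) :=
  ((mdiff_zpow (mdiff_theta0 h₀ h₀') hθ₀ _).mul (mdiff_zpow (mdiff_theta1 h₁) hθ₁ _)).mul
    (mdiff_bolD m (mdiff_bolInner h₀ h₀' h₁ hθ₀ hθ₁ a hf))

/-- Bol's identity carries the slash inside `D^m` at any cusp, where all three factors of `bolInner`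
are known to be meromorphic. -/
lemma isMeromorphicAtInfty_bolDelta (h₀ : ψ₀.IsPrimitive) (h₀' : ψ₀.Even) (h₁ : ψ₁.Odd)
    (hθ₀ : ∀ z, theta0 ψ₀ z ≠ 0) (hθ₁ : ∀ z, theta1 ψ₁ z ≠ 0) (a : ℤ) (m : ℕ) {f : ℍ → ℂ}
    (hf : MDiff f) (γ : SL(2, ℤ)) (hfγ : IsMeromorphicAtInfty (cuspSlash (1 - 2 * m) γ f)) :
    IsMeromorphicAtInfty (cuspSlash (2 * m + 3) γ (bolDelta ψ₀ ψ₁ a m f)) := by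
  have hg := mdiff_bolInner h₀ h₀' h₁ hθ₀ hθ₁ a hf
  have m0 := isMeromorphicAtInfty_theta0 h₀ h₀' γ
  have m1 := isMeromorphicAtInfty_theta1 h₁ γ
  have hin : IsMeromorphicAtInfty (bolInner ψ₀ ψ₁ a f ∣[(1 - m : ℤ)] γ) := by
    rw [funext (bolInner_slash a m f γ)]
    exact ((m0.zpow _).mul (m1.zpow _)).mul hfγ
  have hs : MDiff (bolInner ψ₀ ψ₁ a f ∣[(1 - m : ℤ)] γ) := hg.slash _ _
  have hD := hin.bolD m hs
  rw [bolD_slash m hg γ] at hD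
  rw [funext (cuspSlash_bolDelta a m f γ)]
  exact ((m0.zpow _).mul (m1.zpow _)).mul hD

lemma thetaSlash_bolDelta (h₀ : ψ₀.IsPrimitive) (h₀' : ψ₀.Even) (h₁ : ψ₁.Odd)
    (hθ₀ : ∀ z, theta0 ψ₀ z ≠ 0) (hθ₁ : ∀ z, theta1 ψ₁ z ≠ 0) (a : ℤ) (m : ℕ) {f : ℍ → ℂ}
    (hf : MDiff f) {γ : SL(2, ℤ)} (hγ₀ : (4 * (N₀ : ℤ) ^ 2) ∣ γ 1 0)
    (hγ₁ : (4 * (N₁ : ℤ) ^ 2) ∣ γ 1 0) (hψ₀ : ψ₀ (γ 1 1 : ℤ) ≠ 0) (hψ₁ : ψ₁ (γ 1 1 : ℤ) ≠ 0)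
    {C : ℂ} (hfγ : ∀ z, thetaSlash (1 - 2 * m) γ f z = C * f z) (z : ℍ) :
    thetaSlash (2 * m + 3) γ (bolDelta ψ₀ ψ₁ a m f) z =
      C * epsilonOdd (γ 1 1) ^ 2 * (ψ₁ (γ 1 1 : ℤ) / ψ₀ (γ 1 1 : ℤ)) *
        bolDelta ψ₀ ψ₁ a m f z := by
  have hg := mdiff_bolInner h₀ h₀' h₁ hθ₀ hθ₁ a hf
  set ε := epsilonOdd (γ 1 1) with hε
  set c₀ := ψ₀ (γ 1 1 : ℤ) with hc₀
  set c₁ := ψ₁ (γ 1 1 : ℤ) with hc₁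
  have hε0 : ε ≠ 0 := epsilonOdd_ne_zero _
  have hεc : ε ^ 2 * c₁ ≠ 0 := mul_ne_zero (pow_ne_zero 2 hε0) hψ₁
  have t0 := theta0_smul h₀ h₀' hγ₀
  have t1 := theta1_smul h₁ hγ₁
  have o1 : Odd (1 - 2 * m : ℤ) := ⟨-m, by ring⟩
  have o2 : Odd (2 * m + 3 : ℤ) := ⟨m + 1, by ring⟩
  -- The inner function is an eigenfunction of the slash; the constant then passes through `D^m`.
  have hin : bolInner ψ₀ ψ₁ a f ∣[(1 - m : ℤ)] γ =
      ((ε ^ 2) ^ (-(1 - m : ℤ)) * (c₀ ^ (1 - 3 * a) * (ε ^ 2 * c₁) ^ a * C)) •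
        bolInner ψ₀ ψ₁ a f := by
    ext w
    have h := zpow_weight_inner (thetaFactor_ne_zero γ w) (theta0 ψ₀ (γ • w)) (theta1 ψ₁ (γ • w))
      (f (γ • w)) a m
    rw [t0, t1, ← thetaSlash_eq o1, hfγ, show (2 : ℤ) - 2 * m = 2 * (1 - m) by ring, zpow_two_mul,
      thetaFactor_sq, mul_zpow (epsilonOdd (γ 1 1) ^ 2), inv_zpow', ← hε, ← hc₀, ← hc₁, mul_zpow c₀,
      mul_zpow (ε ^ 2 * c₁)] at h
    have hi : (ε ^ 2) ^ (-(1 - m : ℤ)) * (ε ^ 2) ^ (1 - m : ℤ) = 1 :=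
      zpow_neg_mul_zpow_self _ (pow_ne_zero 2 hε0)
    rw [slash_int_apply, Pi.smul_apply, smul_eq_mul, bolInner, bolInner]
    linear_combination (ε ^ 2) ^ (-(1 - m : ℤ)) * h - (((γ 1 0 : ℂ) * w + γ 1 1) ^ (-(1 - m : ℤ)) *
      (theta0 ψ₀ (γ • w) ^ (1 - 3 * a) * theta1 ψ₁ (γ • w) ^ a * f (γ • w))) * hi
  have hB := bolD_slash m hg γ
  rw [hin, bolD_const_smul m _ hg] at hB
  have hBz := congrFun hB z
  rw [Pi.smul_apply, smul_eq_mul, slash_int_apply] at hBz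
  rw [thetaSlash_eq o2, bolDelta, zpow_weight_outer (thetaFactor_ne_zero γ z), t0, t1,
    show (2 : ℤ) + 2 * m = 2 * (1 + m) by ring, zpow_two_mul, thetaFactor_sq,
    mul_zpow (epsilonOdd (γ 1 1) ^ 2), inv_zpow', ← hε, ← hc₀, ← hc₁, mul_assoc ((ε ^ 2) ^ (1 + m : ℤ)), mul_comm ((_ : ℂ) ^ (-(1 + m : ℤ)))]
  change _ * (_ * (bolD m (bolInner ψ₀ ψ₁ a f) (γ • z) * _)) =
    _ * (_ * _ * bolD m (bolInner ψ₀ ψ₁ a f) z)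
  rw [← hBz, mul_zpow c₀, mul_zpow (ε ^ 2 * c₁)]
  have e0 : (ε ^ 2) ^ (2 : ℤ) = 1 := by
    have := epsilonOdd_pow_four (γ 1 1)
    rw [← hε] at this
    norm_cast
    rw [← pow_mul, this]
  -- Trading `thetaFactor` for `cz + d` inside and outside leaves `(ε²)^(2m)`, which is `1` because
  -- `ε⁴ = 1`.
  have e1 : (ε ^ 2) ^ (1 + m : ℤ) * (ε ^ 2) ^ (-(1 - m : ℤ)) = 1 := by
    rw [← zpow_add₀ (pow_ne_zero 2 hε0), show (1 + m : ℤ) + -(1 - m) = 2 * m by ring, zpow_mul, e0,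
      one_zpow]
  have e2 : c₀ ^ (3 * a - 2) * c₀ ^ (1 - 3 * a) = c₀⁻¹ := by
    rw [← zpow_add₀ hψ₀, ← zpow_neg_one]; congr 1; ring
  have e3 : (ε ^ 2 * c₁) ^ (1 - a) * (ε ^ 2 * c₁) ^ a = ε ^ 2 * c₁ := by
    rw [← zpow_add₀ hεc, sub_add_cancel, zpow_one]
  calc _ = (c₀ ^ (3 * a - 2) * c₀ ^ (1 - 3 * a)) * ((ε ^ 2 * c₁) ^ (1 - a) * (ε ^ 2 * c₁) ^ a) *
        ((ε ^ 2) ^ (1 + m : ℤ) * (ε ^ 2) ^ (-(1 - m : ℤ))) * C *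
        (theta0 ψ₀ z ^ (3 * a - 2) * theta1 ψ₁ z ^ (1 - a) *
          bolD m (bolInner ψ₀ ψ₁ a f) z) := by ring
    _ = _ := by rw [e1, e2, e3]; ring

end

end HalfIntegralBol
end

open HalfIntegralBol
/-- Here `k = m + 3/2` with `m : ℕ`, so `2 - k = 1/2 - m = (1 - 2m)/2` and `k = (2m + 3)/2`. -/
theorem mainTheorem2
    {N₀ N₁ : ℕ} (hN₀ : 0 < N₀) (hN₁ : 0 < N₁)
    (ψ₀ : DirichletCharacter ℂ N₀) (ψ₁ : DirichletCharacter ℂ N₁)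
    (h₀_real : ∀ u : ZMod N₀, (ψ₀ u).im = 0) (h₀_prim : ψ₀.IsPrimitive) (h₀_even : ψ₀.Even)
    (h₁_real : ∀ u : ZMod N₁, (ψ₁ u).im = 0) (h₁_prim : ψ₁.IsPrimitive) (h₁_odd : ψ₁.Odd)
    (hθ₀ : ∀ z : UpperHalfPlane, theta0 ψ₀ z ≠ 0)
    (hθ₁ : ∀ z : UpperHalfPlane, theta1 ψ₁ z ≠ 0)
    (N : ℕ) (hN : N = Nat.lcm (4 * N₀ ^ 2) (4 * N₁ ^ 2)) (a : ℤ) :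
    (∀ (m : ℕ) (ψ : DirichletCharacter ℂ N) (f : UpperHalfPlane → ℂ),
      IsWeaklyHolomorphic (1 - 2 * m) N ψ f →
        ∃ χ : DirichletCharacter ℂ N,
          (∀ d : ℤ, IsCoprime d (N : ℤ) →
            χ (d : ZMod N) = ψ (d : ZMod N) * (kroneckerOdd (-1) d : ℂ) *
              (ψ₁ (d : ZMod N₁) / ψ₀ (d : ZMod N₀))) ∧
          IsWeaklyHolomorphic (2 * m + 3) N χ (bolDelta ψ₀ ψ₁ a m f)) ∧
    bolDelta ψ₀ ψ₁ a 0 (theta0 ψ₀) = theta1 ψ₁ := by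
  have : NeZero N₀ := ⟨hN₀.ne'⟩
  have : NeZero N₁ := ⟨hN₁.ne'⟩
  constructor
  · intro m ψ f hf
    have d0 : 4 * N₀ ^ 2 ∣ N := hN ▸ Nat.dvd_lcm_left _ _
    have d1 : 4 * N₁ ^ 2 ∣ N := hN ▸ Nat.dvd_lcm_right _ _
    have d0' : 4 * (N₀ : ℤ) ^ 2 ∣ (N : ℤ) := by exact_mod_cast d0
    have d1' : 4 * (N₁ : ℤ) ^ 2 ∣ (N : ℤ) := by exact_mod_cast d1
    have n0 : N₀ ∣ N := (Dvd.intro_left (4 * N₀) (by ring)).trans d0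
    have n1 : N₁ ∣ N := (Dvd.intro_left (4 * N₁) (by ring)).trans d1
    have n4 : 4 ∣ N := (Dvd.intro _ rfl).trans d0
    obtain ⟨χ, hχ⟩ := exists_character n0 n1 n4 ψ₀ ψ₁ ψ
    refine ⟨χ, hχ, mdiff_bolDelta h₀_prim h₀_even h₁_odd hθ₀ hθ₁ a m hf.holo, fun γ hγ z => ?_,
      fun γ => isMeromorphicAtInfty_bolDelta h₀_prim h₀_even h₁_odd hθ₀ hθ₁ a m hf.holo γ
        (hf.meromorphic_at_cusps γ)⟩
    have hc : (N : ℤ) ∣ γ 1 0 :=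
      (ZMod.intCast_zmod_eq_zero_iff_dvd _ _).1 (CongruenceSubgroup.Gamma0_mem.1 hγ)
    have hcop : IsCoprime (γ 1 1) (N : ℤ) := (isCoprime_row γ).symm.of_isCoprime_of_dvd_right hc
    have hodd : Odd (γ 1 1) := by
      have h2 : (2 : ℤ) ∣ N := by exact_mod_cast (show 2 ∣ 4 by norm_num).trans n4
      rw [← Int.not_even_iff_odd]
      intro he
      have := (hcop.of_isCoprime_of_dvd_right h2).isUnit_of_dvd' (even_iff_two_dvd.1 he) dvd_rfl
      exact absurd (Int.isUnit_iff.1 this) (by norm_num)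
    have nz : ∀ {n : ℕ} (χ : DirichletCharacter ℂ n), n ∣ N → χ (γ 1 1 : ℤ) ≠ 0 := by
      intro n χ hn
      have : IsCoprime (γ 1 1) (n : ℤ) :=
        hcop.of_isCoprime_of_dvd_right (by exact_mod_cast hn)
      rw [← ZMod.coe_unitOfIsCoprime _ this]
      exact ((ZMod.unitOfIsCoprime _ this).isUnit.map χ).ne_zero
    rw [thetaSlash_bolDelta h₀_prim h₀_even h₁_odd hθ₀ hθ₁ a m hf.holo
      (d0'.trans hc)
      (d1'.trans hc) (nz ψ₀ n0) (nz ψ₁ n1)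
      (hf.slash_eq γ hγ), hχ _ hcop, epsilonOdd_sq hodd]
  · ext z
    have h0 := hθ₀ z
    have h1 := hθ₁ z
    -- `D^0` is the identity, so only exponents remain to be added.
    change theta0 ψ₀ z ^ (3 * a - 2) * theta1 ψ₁ z ^ (1 - a) *
      (theta0 ψ₀ z ^ (1 - 3 * a) * theta1 ψ₁ z ^ a * theta0 ψ₀ z) = theta1 ψ₁ z
    calc _ = (theta0 ψ₀ z ^ (3 * a - 2) * theta0 ψ₀ z ^ (1 - 3 * a) * theta0 ψ₀ z) *
          (theta1 ψ₁ z ^ (1 - a) * theta1 ψ₁ z ^ a) := by ring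
      _ = _ := by
        rw [← zpow_add₀ h0, ← zpow_add_one₀ h0, ← zpow_add₀ h1, sub_add_cancel, zpow_one,
          show 3 * a - 2 + (1 - 3 * a) + 1 = 0 by ring, zpow_zero, one_mul]
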